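/- **Setting.** A glue is a pair (label, strength), where the label is a finite string and the strength is a nonnegative integer; a tile type assigns a glue to each of the four sides of a unit square (tiles are not rotated). An assembly over a finite set $T$ of tile types is a partial function $\alpha:\mathbb Z^2\dashrightarrow T$, finite or infinite. Two adjacent tiles are joined by an edge of weight $s$ in the binding graph if the glues on their abutting sides are equal and have strength $s>0$; $\alpha$ is $\tau$-stable if every cut of its binding graph has weight at least $\tau$. The supertile $\tilde\alpha$ is the set of all translations of $\alpha$. For supertiles $\tilde\alpha,\tilde\beta$ let $C^\tau_{\tilde\alpha,\tilde\beta}$ be the set of supertiles of all $\tau$-stable unions of a member of $\tilde\alpha$ with a disjoint member of $\tilde\beta$. A 2HAM system is a triple $\mathcal T=(T,\sigma,\tau)$ of a finite set $T$ of tile types, an initial state $\sigma$, i.e. a set of nonempty $\tau$-stable supertiles over $T$ each present with infinite multiplicity, and a temperature $\tau\in\mathbb N$. We write $\|\sigma\|$ for the number (cardinality) of distinct supertiles in $\sigma$. A supertile is producible if it is the result (union) of a finite or infinite sequence that starts with a member of $\sigma$ and in each step attaches (via $C^\tau$) a supertile obtained from $\sigma$ by finitely many attachments; $\mathcal A[\mathcal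 T]$ is the set of producible supertiles. Write $\tilde\alpha\to^1_{\mathcal T}\tilde\beta$ if $\tilde\beta\in C^\tau_{\tilde\alpha,\tilde\gamma}$ for some $\tilde\gamma\in\mathcal A[\mathcal T]$, $\tilde\alpha\to^{\le1}_{\mathcal T}\tilde\beta$ if $\tilde\alpha=\tilde\beta$ or $\tilde\alpha\to^1_{\mathcal T}\tilde\beta$, and $\tilde\alpha\to_{\mathcal T}\tilde\beta$ if $\tilde\beta$ is the result of a finite (possibly empty) or infinite sequence of attachments of producible supertiles starting from $\tilde\alpha$. **Strong simulation.** Let $\mathcal U=(U,S,\tau')$ and $\mathcal T=(T,\sigma,\tau)$ be 2HAM systems, $m\ge1$, and let $R$ be a partial function from $m$-blocks over $U$ (partial functions $\{0,\dots,m-1\}^2\dashrightarrow U$) to $T$. For an assembly $\alpha$ over $U$ let $\alpha^m_{x,y}(i,j)=\alpha(mx+i,my+j)$ and $R^*(\alpha)(x,y)=R(\alpha^m_{x,y})$; $\alpha$ represents something if $R^*(\alpha)$ is nonempty. Let $\tilde R(\tilde\alpha)=\{R^*(\alpha'):\alpha'\in\tilde\alpha,\ R^*(\alpha')\text{ nonempty}\}$.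 Then $\mathcal U$ strongly simulates $\mathcal T$ at scale $m$ via $R$ if: 1. $\{\tilde R(\tilde\alpha):\tilde\alpha\in\mathcal A[\mathcal U],\ \tilde R(\tilde\alpha)\neq\emptyset\}=\mathcal A[\mathcal T]$, and every $\tilde\alpha\in\mathcal A[\mathcal U]$ maps cleanly: if $\tilde R(\tilde\alpha)\ne\emptyset$, then $\tilde R(\tilde\alpha)$ is a supertile over $T$ and for each $\alpha'\in\tilde\alpha$ that represents something, either every nonempty block of $\alpha'$ is at, or directly north, south, east or west of, a cell of $\operatorname{dom}R^*(\alpha')$, or $\alpha'$ has at most one nonempty block; if $\tilde R(\tilde\alpha)=\emptyset$, then some translation of $\tilde\alpha$ has at most one nonempty block. 2. If $\tilde\alpha,\tilde\beta\in\mathcal A[\mathcal U]$, $\tilde\alpha\to^1_{\mathcal U}\tilde\beta$ and $\tilde R(\tilde\alpha)\neq\emptyset$, then $\tilde R(\tilde\alpha)\to^{\le1}_{\mathcal T}\tilde R(\tilde\beta)$. 3. If $\tilde\alpha,\tilde\beta\in\mathcal A[\mathcal T]$ and $\tilde\gamma\in C^\tau_{\tilde\alpha,\tilde\beta}$, then for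 all $\tilde\alpha',\tilde\beta'\in\mathcal A[\mathcal U]$ with $\tilde R(\tilde\alpha')=\tilde\alpha$ and $\tilde R(\tilde\beta')=\tilde\beta$ there are $\tilde\alpha'',\tilde\beta'',\tilde\gamma'\in\mathcal A[\mathcal U]$ with $\tilde\alpha'\to_{\mathcal U}\tilde\alpha''$, $\tilde\beta'\to_{\mathcal U}\tilde\beta''$, $\tilde R(\tilde\alpha'')=\tilde\alpha$, $\tilde R(\tilde\beta'')=\tilde\beta$, $\tilde R(\tilde\gamma')=\tilde\gamma$ and $\tilde\gamma'\in C^{\tau'}_{\tilde\alpha'',\tilde\beta''}$. **Theorem.** There are absolute constants $c$ and $C$ such that for every integer $\tau\ge2$ there is a set $U_\tau$ of at most $c$ tile types with the following property. For every 2HAM system $\mathcal T=(T,\sigma,\tau)$ with $T\neq\emptyset$ there is a set $I_{\mathcal T}$ of exactly $\|\sigma\|$ supertiles over $U_\tau$ (all finite if all supertiles in $\sigma$ are finite) such that the 2HAM system $\mathcal U_{\mathcal T}=(U_\tau,\,U_{\tau,\mathrm{sup}}\cup I_{\mathcal T},\,\tau)$, where $U_{\tau,\mathrm{sup}}$ is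 the set of single-tile supertiles over $U_\tau$, strongly simulates $\mathcal T$ at some scale $m$ with $1\le m\le C\sqrt{|G|\,(\tau+\log|G|)}$, where $G$ is the set of glues that occur on the tile types in $T$. -/

import Mathlib

/-! The two-handed tile assembly model (2HAM) and strong simulation between 2HAM systems. -/

namespace TwoHAM

/-- The four sides of a unit square tile. -/
inductive Dir
  | north
  | east
  | south
  | west

/-- The unit vector pointing from a cell to its neighbour in direction `d`. -/
def Dir.vec : Dir → ℤ × ℤ
  | .north => (0, 1)
  | .east => (1, 0)
  | .south => (0, -1)
  | .west => (-1, 0)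

/-- The opposite side. -/
def Dir.opp : Dir → Dir
  | .north => .south
  | .east => .west
  | .south => .north
  | .west => .east

/-- A glue: a label (a finite string) and a nonnegative integer strength. -/
structure Glue where
  label : String
  strength : ℕ

/-- A tile type is given by the glues on its four sides (tiles are not rotated). -/
abbrev Tile := Dir → Glue

/-- The set of glues that occur on the tile types in `T`. -/
def glues (T : Finset Tile) : Set Glue := {g | ∃ t ∈ T, ∃ d : Dir, t d = g}

/-- An assembly: a partial placement of tiles on the integer lattice, finite or infinite. -/
abbrev Assembly := ℤ × ℤ → Option Tile

/-- The set of cells that carry a tile. -/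
def dom (α : Assembly) : Set (ℤ × ℤ) := {x | α x ≠ none}

/-- All tiles of `α` are taken from the tile set `T`. -/
def IsOver (T : Finset Tile) (α : Assembly) : Prop := ∀ x t, α x = some t → t ∈ T

/-- The translated assembly `α + u`. -/
def translate (u : ℤ × ℤ) (α : Assembly) : Assembly := fun x => α (x - u)

/-- The union of two assemblies (only used when their domains are disjoint). -/
def union (α β : Assembly) : Assembly := fun x => (α x).orElse fun _ => β x

/-- The weight of the edge of the binding graph between `x` and its neighbour in direction `d`:
the strength of the common glue if both cells carry tiles and the abutting glues are equal,
and `0` otherwise (in particular if there is no edge). -/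
noncomputable def bond (α : Assembly) (x : ℤ × ℤ) (d : Dir) : ℕ :=
  open Classical in
  match α x, α (x + d.vec) with
  | some s, some t => if s d = t d.opp then (s d).strength else 0
  | _, _ => 0

/-- `α` is `τ`-stable: every cut of its binding graph (into the part inside `A` and the part
outside `A`, both nonempty) has weight at least `τ`. The assembly, and hence the cut, may be
infinite; weight at least `τ` is reached by finitely many of the crossing edges. Every crossing
edge is listed once, as a pair (its end in `A`, direction). -/
def Stable (τ : ℕ) (α : Assembly) : Prop :=
  ∀ A : Set (ℤ × ℤ), (dom α ∩ A).Nonempty → (dom α \ A).Nonempty →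
    ∃ F : Finset ((ℤ × ℤ) × Dir),
      (∀ p ∈ F, p.1 ∈ A ∧ p.1 + p.2.vec ∉ A) ∧ τ ≤ ∑ p ∈ F, bond α p.1 p.2

/-- The supertile of `α`: the set of all translations of `α`. -/
def supertile (α : Assembly) : Set Assembly := {β | ∃ u : ℤ × ℤ, β = translate u α}

/-- The combination set: all `τ`-stable supertiles obtained by attaching a member of `a` to a
disjoint member of `b`. -/
def combine (τ : ℕ) (a b : Set Assembly) : Set (Set Assembly) :=
  {c | ∃ α ∈ a, ∃ β ∈ b, Disjoint (dom α) (dom β) ∧ Stable τ (union α β) ∧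
    c = supertile (union α β)}

/-- A 2HAM tile assembly system: a finite set of tile types, an initial state and a temperature.
The initial state is a set of supertiles, each of which is present with infinite multiplicity. -/
structure TAS where
  tiles : Finset Tile
  init : Set (Set Assembly)
  temp : ℕ
  init_spec : ∀ s ∈ init, ∃ α : Assembly,
    (dom α).Nonempty ∧ IsOver tiles α ∧ Stable temp α ∧ s = supertile α

/-- The supertiles that are obtained from the initial state by finitely many attachments. -/
inductive Reachable (S : TAS) : Set Assembly → Prop
  | init (s : Set Assembly) (hs : s ∈ S.init) : Reachable S s
  | attach (a b c : Set Assembly) (ha : Reachable S a) (hb : Reachable S b)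
      (hc : c ∈ combine S.temp a b) : Reachable S c

/-- `b` is the result of a finite or infinite supertile assembly sequence that starts with `a` and
in which supertiles satisfying `P` are attached one after another at temperature `τ`. The sequence
is written with consistently placed representatives `f i`; it may pause, so that a finite sequence
is one that is eventually constant. The result is the union of all `f i`. -/
def Grows (τ : ℕ) (P : Set Assembly → Prop) (a b : Set Assembly) : Prop :=
  ∃ f : ℕ → Assembly, f 0 ∈ a ∧
    (∀ i, f (i + 1) = f i ∨
      ∃ β : Assembly, P (supertile β) ∧ Disjoint (dom (f i)) (dom β) ∧
        Stable τ (union (f i) β) ∧ f (i + 1) = union (f i) β) ∧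
    ∃ γ : Assembly, (∀ x t, γ x = some t ↔ ∃ i, f i x = some t) ∧ b = supertile γ

/-- The producible supertiles: the results of all supertile assembly sequences that start in the
initial state (finite or infinite). -/
def producible (S : TAS) : Set (Set Assembly) :=
  {b | ∃ a ∈ S.init, Grows S.temp (Reachable S) a b}

/-- `a` grows into `b` by the attachment of one producible supertile. -/
def StepTo (S : TAS) (a b : Set Assembly) : Prop :=
  ∃ c ∈ producible S, b ∈ combine S.temp a c

/-- `a` grows into `b` by exactly one attachment, or by none if `a = b`. -/
def StepToLeOne (S : TAS) (a b : Set Assembly) : Prop := a ≠ b → StepTo S a b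

/-- `a` grows into `b` through a finite or infinite sequence of attachments of producible
supertiles. -/
def GrowsTo (S : TAS) (a b : Set Assembly) : Prop :=
  Grows S.temp (fun c => c ∈ producible S) a b

/-- An `m`-block (macrotile): a partial placement of tiles on an `m × m` square. -/
abbrev Block (m : ℕ) := Fin m → Fin m → Option Tile

/-- The `m`-block of `α` at position `(x, y)`. -/
def blockAt (m : ℕ) (α : Assembly) (x y : ℤ) : Block m :=
  fun i j => α ((m : ℤ) * x + (i : ℤ), (m : ℤ) * y + (j : ℤ))

/-- The block carries at least one tile. -/
def Block.NonEmpty {m : ℕ} (b : Block m) : Prop := ∃ i j, b i j ≠ none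

/-- The assembly representation function of a partial map `R` from `m`-blocks to tile types. -/
def repr {m : ℕ} (R : Block m → Option Tile) (α : Assembly) : Assembly :=
  fun p => R (blockAt m α p.1 p.2)

/-- The supertile representation function. An assembly whose representation has no tile
represents nothing and contributes nothing, so the value is `∅` exactly if no translation of the
supertile represents an assembly. -/
def superRepr {m : ℕ} (R : Block m → Option Tile) (a : Set Assembly) : Set Assembly :=
  {β | (dom β).Nonempty ∧ ∃ α ∈ a, repr R α = β}

/-- `α` has at most one nonempty `m`-block. -/
def AtMostOneBlock (m : ℕ) (α : Assembly) : Prop :=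
  ∀ x y x' y' : ℤ, (blockAt m α x y).NonEmpty → (blockAt m α x' y').NonEmpty →
    x = x' ∧ y = y'

/-- `α` maps cleanly to `β`: every nonempty block of `α` is at, or directly north, south, east or
west of, a cell of `β`, or else `α` has at most one nonempty block. -/
def MapsCleanly (m : ℕ) (α β : Assembly) : Prop :=
  (∀ x y : ℤ, (blockAt m α x y).NonEmpty →
    ∃ u v : ℤ, u ∈ ({-1, 0, 1} : Set ℤ) ∧ v ∈ ({-1, 0, 1} : Set ℤ) ∧ u ^ 2 + v ^ 2 < 2 ∧
      (x + u, y + v) ∈ dom β) ∨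
  AtMostOneBlock m α

/-- The supertile `a` maps cleanly: if it represents something, then its representation is a
supertile over `T` and every translation of `a` that represents an assembly maps to it cleanly; if
it represents nothing, then it fits into one block. -/
def SupertileMapsCleanly {m : ℕ} (R : Block m → Option Tile) (T : Finset Tile)
    (a : Set Assembly) : Prop :=
  ((superRepr R a).Nonempty →
    (∃ β : Assembly, IsOver T β ∧ superRepr R a = supertile β) ∧
    ∀ α ∈ a, (dom (repr R α)).Nonempty → MapsCleanly m α (repr R α)) ∧
  (superRepr R a = ∅ → ∃ α ∈ a, AtMostOneBlock m α)

/-- `U` and `T` have equivalent productions. -/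
def EquivalentProductions {m : ℕ} (R : Block m → Option Tile) (U T : TAS) : Prop :=
  {b | ∃ a ∈ producible U, (superRepr R a).Nonempty ∧ superRepr R a = b} = producible T ∧
  ∀ a ∈ producible U, SupertileMapsCleanly R T.tiles a

/-- `T` follows `U`. -/
def Follows {m : ℕ} (R : Block m → Option Tile) (U T : TAS) : Prop :=
  ∀ a ∈ producible U, ∀ b ∈ producible U, StepTo U a b → (superRepr R a).Nonempty →
    StepToLeOne T (superRepr R a) (superRepr R b)

/-- `U` strongly models `T`. -/
def StronglyModels {m : ℕ} (R : Block m → Option Tile) (U T : TAS) : Prop :=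
  ∀ a ∈ producible T, ∀ b ∈ producible T, ∀ c ∈ combine T.temp a b,
    ∀ a' ∈ producible U, ∀ b' ∈ producible U, superRepr R a' = a → superRepr R b' = b →
      ∃ a'' ∈ producible U, ∃ b'' ∈ producible U, ∃ c' ∈ producible U,
        GrowsTo U a' a'' ∧ GrowsTo U b' b'' ∧
        superRepr R a'' = a ∧ superRepr R b'' = b ∧ superRepr R c' = c ∧
        c' ∈ combine U.temp a'' b''

/-- `U` strongly simulates `T` at scale factor `m` under the representation `R`, a partial
function from `m`-blocks to the tile types of `T`. -/
def StronglySimulates {m : ℕ} (R : Block m → Option Tile) (U T : TAS) : Prop :=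
  (∀ b t, R b = some t → t ∈ T.tiles) ∧
  EquivalentProductions R U T ∧ Follows R U T ∧ StronglyModels R U T

open Classical in
/-- The assembly consisting of a single tile of type `t`. -/
noncomputable def single (t : Tile) : Assembly := fun x => if x = (0, 0) then some t else none

/-- The set of all single-tile supertiles over the tile set `U`. -/
def singletons (U : Finset Tile) : Set (Set Assembly) := {s | ∃ t ∈ U, s = supertile (single t)}

end TwoHAM

namespace TwoHAM

/-! ### The shape of a macrotile -/

/-! Every tile is replaced by a rigid macrotile whose outline does not depend on the tile. With N
glues and r about √(Nτ), the outline is a square of side 8r+12 with r hooked slots in each of its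
west and south sides and matching teeth on its east and north sides; its lattice translates
partition the plane (`owner_eq_zero_iff`). The teeth of one side offer r² pad positions, so every
glue can own τ of them. A glue of strength s is written by activating the first min(s, τ) of its
positions. An active pad has strength 1; everything else on the boundary has strength 0.

The geometry replaces a rich glue alphabet. If pads of two disjoint macrotiles touch, the tooth must
be fully inserted in its own slot (`pads_aligned`). Hence macrotiles bind only as lattice
neighbours, and only through pads of a glue that both abutting sides carry (`Code.contact`): the
weight is min(s, τ) if the glues agree and 0 otherwise. The truncation at τ is harmless, since no
cut has to weigh more.

Inner edges have strength ⌈τ/2⌉. The outline is a connected union of 2 × 2 squares, so a cut through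
a macrotile crosses two inner edges (`exists_two_crossings`) and weighs at least τ. Consequently an
assembly is stable exactly if its enlargement is (`Code.stable_of_stable_enlarge`,
`Code.stable_enlarge`).

Loose tiles are inert: all glues are weaker than τ, two tiles share only one edge, and a complete
macrotile binds to the outside only through active pads, of which no tile in the universal set has
two. So the producible supertiles are the single tiles and the enlargements of the producible
supertiles of the simulated system (`Code.Fits.producible_cases`, `Code.Fits.producible_enlarge`),
and attachments correspond one to one. A record of the four glues in the interior allows a block to
be decoded. The palette has six glues that depend only on τ, whence at most 6⁴ tile types. -/

/-- The slots cut into the west side of the square `[0, 8r+12)²`: `r` hooked horizontal corridors,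
all lengths doubled so that the shape consists of `2 × 2` squares. -/
def slot (r x y : ℤ) : Prop :=
  0 ≤ x ∧ x / 2 ≤ r ∧ r + 2 ≤ y / 2 ∧ y / 2 < 4 * r + 2 ∧
    ((y / 2 - r - 2) % 3 = 2 ∨ ((y / 2 - r - 2) % 3 = 1 ∧ x / 2 = r))

/-- The macrotile: the square without the slots in its west and south sides, together with the
teeth on its east and north sides that fit into the slots of the neighbours. -/
def shape (r x y : ℤ) : Prop :=
  (0 ≤ x ∧ x < 8 * r + 12 ∧ 0 ≤ y ∧ y < 8 * r + 12 ∧ ¬ slot r x y ∧ ¬ slot r y x) ∨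
    slot r (x - (8 * r + 12)) y ∨ slot r (y - (8 * r + 12)) x

theorem shape_swap {r x y : ℤ} : shape r x y ↔ shape r y x := by
  unfold shape
  tauto

open Classical in
/-- The index of the macrotile that covers the cell `(x, y)`. -/
noncomputable def owner (r x y : ℤ) : ℤ × ℤ :=
  if slot r (x % (8 * r + 12)) (y % (8 * r + 12)) then
    (x / (8 * r + 12) - 1, y / (8 * r + 12))
  else if slot r (y % (8 * r + 12)) (x % (8 * r + 12)) then
    (x / (8 * r + 12), y / (8 * r + 12) - 1)
  else (x / (8 * r + 12), y / (8 * r + 12))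

theorem owner_add {r : ℤ} (hr : 1 ≤ r) (x y u v : ℤ) :
    owner r (x + (8 * r + 12) * u) (y + (8 * r + 12) * v) =
      ((owner r x y).1 + u, (owner r x y).2 + v) := by
  have h : (8 * r + 12) ≠ 0 := by omega
  have e1 := fun a b : ℤ => Int.add_mul_emod_self_left a (8 * r + 12) b
  have e2 := fun a b : ℤ => Int.add_mul_ediv_left a b h
  unfold owner
  rw [e1, e1, e2, e2]
  split_ifs <;> ext <;> dsimp only <;> ring

/-- West and south slots of a square are disjoint, and they are filled exactly by the teeth of the
west and south neighbours. So the translates of `shape` by multiples of 8r+12 partition the plane.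
-/
theorem owner_eq_zero_iff {r : ℤ} (hr : 1 ≤ r) (x y : ℤ) :
    owner r x y = (0, 0) ↔ shape r x y := by
  obtain ⟨m, hm⟩ : ∃ m, m = 8 * r + 12 := ⟨_, rfl⟩
  have hx := Int.emod_add_mul_ediv x m
  have hy := Int.emod_add_mul_ediv y m
  have hx0 := Int.emod_nonneg x (show m ≠ 0 by omega)
  have hy0 := Int.emod_nonneg y (show m ≠ 0 by omega)
  have hx1 := Int.emod_lt_of_pos x (show 0 < m by omega)
  have hy1 := Int.emod_lt_of_pos y (show 0 < m by omega)
  unfold owner shape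
  rw [← hm]
  generalize x % m = a at *
  generalize y % m = b at *
  generalize x / m = p at *
  generalize y / m = q at *
  constructor
  · intro h
    split_ifs at h with h1 h2 <;> rw [Prod.mk.injEq] at h
    · obtain rfl : p = 1 := by omega
      obtain rfl : q = 0 := h.2
      right; left
      convert h1 using 1 <;> linarith
    · obtain rfl : q = 1 := by omega
      obtain rfl : p = 0 := h.1
      right; right
      convert h2 using 1 <;> linarith
    · obtain ⟨rfl, rfl⟩ := h
      left
      have e1 : x = a := by linarith
      have e2 : y = b := by linarith
      subst e1 e2
      exact ⟨hx0, hx1, hy0, hy1, h1, h2⟩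
  · have key : ∀ z c t i : ℤ, c + m * t = z → 0 ≤ c → c < m → m * i ≤ z → z < m * (i + 1) →
        t = i := by
      intro z c t i h1 h2 h3 h4 h5
      have : t < i + 1 := by nlinarith
      have : i < t + 1 := by nlinarith
      omega
    rintro (⟨h1, h2, h3, h4, h5, h6⟩ | h | h)
    · obtain rfl : p = 0 := key x a p 0 hx hx0 hx1 (by omega) (by omega)
      obtain rfl : q = 0 := key y b q 0 hy hy0 hy1 (by omega) (by omega)
      obtain rfl : a = x := by linarith
      obtain rfl : b = y := by linarith
      rw [if_neg h5, if_neg h6]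
    · have h' := h
      unfold slot at h'
      obtain rfl : p = 1 := key x a p 1 hx hx0 hx1 (by omega) (by omega)
      obtain rfl : q = 0 := key y b q 0 hy hy0 hy1 (by omega) (by omega)
      rw [if_pos]
      · simp
      · convert h using 1 <;> linarith
    · have h' := h
      unfold slot at h'
      obtain rfl : p = 0 := key x a p 0 hx hx0 hx1 (by omega) (by omega)
      obtain rfl : q = 1 := key y b q 1 hy hy0 hy1 (by omega) (by omega)
      have e1 : a = x := by linarith
      have e2 : b = y - m := by linarith
      rw [if_neg, if_pos]
      · simp
      · rwa [e1, e2]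
      · unfold slot; omega

theorem owner_eq_iff {r : ℤ} (hr : 1 ≤ r) (x y : ℤ) (p : ℤ × ℤ) :
    owner r x y = p ↔ shape r (x - (8 * r + 12) * p.1) (y - (8 * r + 12) * p.2) := by
  rw [← owner_eq_zero_iff hr]
  have := owner_add hr (x - (8 * r + 12) * p.1) (y - (8 * r + 12) * p.2) p.1 p.2
  rw [sub_add_cancel, sub_add_cancel] at this
  rw [this, Prod.ext_iff, Prod.ext_iff]
  simp

/-- A cell lies in the block of the macrotile that covers it, or in the block directly to the east
or to the north. -/
theorem owner_cases (r x y : ℤ) :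
    let q := (x / (8 * r + 12), y / (8 * r + 12))
    owner r x y = (q.1 - 1, q.2) ∨ owner r x y = (q.1, q.2 - 1) ∨ owner r x y = q := by
  dsimp only
  unfold owner
  split_ifs <;> simp

theorem shape_bounds {r x y : ℤ} (h : shape r x y) :
    0 ≤ x ∧ x < 2 * (8 * r + 12) ∧ 0 ≤ y ∧ y < 2 * (8 * r + 12) := by
  unfold shape slot at h
  omega

theorem shape_origin {r : ℤ} (hr : 1 ≤ r) : shape r 0 0 := by
  unfold shape slot; omega

theorem shape_origin_west {r : ℤ} (hr : 1 ≤ r) : ¬ shape r (-1) 0 := by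
  unfold shape slot; omega

/-- No slot reaches this region; the record of the four glues is kept here. -/
theorem shape_center {r x y : ℤ} (hr : 1 ≤ r) (hx : 2 * r + 2 ≤ x) (hx' : x < 8 * r + 12)
    (hy : 2 * r + 2 ≤ y) (hy' : y < 8 * r + 12) : shape r x y := by
  unfold shape slot; omega

/-- The positions, relative to the first one, of the pads on the teeth. -/
def PadRange (r i k : ℤ) : Prop := 0 ≤ i ∧ i < r ∧ 0 ≤ k ∧ k < 6 * r ∧ k % 6 = 0

/-- The offset 2r+9 selects the upper of the two cell rows of the straight part of a tooth. The next
row, 2r+10, is the ceiling of the slot that receives it, so pads sit on north faces of teeth and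
south faces of ceilings. -/
theorem shape_tooth {r i k : ℤ} (h : PadRange r i k) :
    shape r (i + (8 * r + 12)) (k + (2 * r + 9)) := by
  unfold PadRange at h; unfold shape slot; omega

theorem shape_ceiling {r i k : ℤ} (h : PadRange r i k) : shape r i (k + (2 * r + 10)) := by
  unfold PadRange at h; unfold shape slot; omega

/-- The locking property: if a pad on a tooth of a macrotile touches a pad in a slot of a disjoint
macrotile, then the tooth is completely inserted in its own slot. -/
theorem pads_aligned {r i k i' k' : ℤ} (h : PadRange r i k) (h' : PadRange r i' k')
    (hd : ∀ x y, shape r x y → ¬ shape r (x - (8 * r + 12 + i - i')) (y - (k - k'))) :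
    i = i' ∧ k = k' := by
  unfold PadRange at h h'
  -- Tooth inserted too deep: its tip would lie in the solid part behind the end of the slot.
  have e1 : ¬ i < i' := by
    intro hlt
    apply hd (8 * r + 12 + 2 * r + 1) (k + 2 * r + 8) <;> unfold shape slot <;> omega
  -- Tooth not inserted far enough: its hook would lie in the wall below the corridor.
  have e2 : ¬ i' < i := by
    intro hlt
    apply hd (8 * r + 12 + 2 * r) (k + 2 * r + 6) <;> unfold shape slot <;> omega
  obtain rfl : i = i' := by omega
  -- Tooth in too high a slot: some tooth of the comb would hit the solid part above the last slot.
  have e3 : ¬ k < k' := by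
    intro hlt
    apply hd (8 * r + 12) (6 * r - (k' - k) + 2 * r + 8) <;> unfold shape slot <;> omega
  -- Tooth in too low a slot: some tooth would hit the solid part below the first slot.
  have e4 : ¬ k' < k := by
    intro hlt
    apply hd (8 * r + 12) (k - k' - 6 + 2 * r + 8) <;> unfold shape slot <;> omega
  omega

/-- `slot` in units of `2 × 2` squares. -/
def coarseSlot (r x y : ℤ) : Prop :=
  0 ≤ x ∧ x ≤ r ∧ r + 2 ≤ y ∧ y < 4 * r + 2 ∧ ((y - r - 2) % 3 = 2 ∨ ((y - r - 2) % 3 = 1 ∧ x = r))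

/-- `shape` in units of `2 × 2` squares. -/
def coarseShape (r x y : ℤ) : Prop :=
  (0 ≤ x ∧ x < 4 * r + 6 ∧ 0 ≤ y ∧ y < 4 * r + 6 ∧ ¬ coarseSlot r x y ∧ ¬ coarseSlot r y x) ∨
    coarseSlot r (x - (4 * r + 6)) y ∨ coarseSlot r (y - (4 * r + 6)) x

/-! ### Connectivity of the macrotile -/

theorem slot_iff {r x y : ℤ} : slot r x y ↔ coarseSlot r (x / 2) (y / 2) := by
  unfold slot coarseSlot
  rw [show 0 ≤ x ↔ 0 ≤ x / 2 by omega]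

theorem shape_iff {r x y : ℤ} : shape r x y ↔ coarseShape r (x / 2) (y / 2) := by
  unfold shape coarseShape
  rw [slot_iff, slot_iff, slot_iff, slot_iff,
    show (x - (8 * r + 12)) / 2 = x / 2 - (4 * r + 6) by omega,
    show (y - (8 * r + 12)) / 2 = y / 2 - (4 * r + 6) by omega,
    show 0 ≤ x ↔ 0 ≤ x / 2 by omega, show 0 ≤ y ↔ 0 ≤ y / 2 by omega,
    show x < 8 * r + 12 ↔ x / 2 < 4 * r + 6 by omega,
    show y < 8 * r + 12 ↔ y / 2 < 4 * r + 6 by omega]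

-- Connectedness, phrased as the constancy of every locally constant predicate. The centre (r+1,
-- r+1) is the inner corner between the two families of slots; every square has a path inside the
-- shape to a square closer to it in the ℓ¹ distance.
set_option maxHeartbeats 1000000 in
theorem coarseShape_connected {r : ℤ} (hr : 1 ≤ r) (Q : ℤ → ℤ → Prop)
    (hx : ∀ x y, coarseShape r x y → coarseShape r (x + 1) y → (Q x y ↔ Q (x + 1) y))
    (hy : ∀ x y, coarseShape r x y → coarseShape r x (y + 1) → (Q x y ↔ Q x (y + 1))) :
    ∀ x y, coarseShape r x y → (Q x y ↔ Q (r + 1) (r + 1)) := by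
  have east : ∀ x y, coarseShape r x y → coarseShape r (x + 1) y →
      (Q x y ↔ Q (x + 1) y) := hx
  have west : ∀ x y, coarseShape r x y → coarseShape r (x - 1) y →
      (Q x y ↔ Q (x - 1) y) := by
    intro x y h h'
    have := hx (x - 1) y h'
    rw [sub_add_cancel] at this
    exact (this h).symm
  have north : ∀ x y, coarseShape r x y → coarseShape r x (y + 1) →
      (Q x y ↔ Q x (y + 1)) := hy
  have south : ∀ x y, coarseShape r x y → coarseShape r x (y - 1) →
      (Q x y ↔ Q x (y - 1)) := by
    intro x y h h'
    have := hy x (y - 1) h'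
    rw [sub_add_cancel] at this
    exact (this h).symm
  have main : ∀ n : ℕ, ∀ x y, (x - (r + 1)).natAbs + (y - (r + 1)).natAbs ≤ n →
      coarseShape r x y → (Q x y ↔ Q (r + 1) (r + 1)) := by
    intro n
    induction n with
    | zero =>
      intro x y hn _
      obtain rfl : x = r + 1 := by omega
      obtain rfl : y = r + 1 := by omega
      rfl
    | succ n ih =>
      intro x y hn h
      by_cases h0 : x = r + 1 ∧ y = r + 1
      · rw [h0.1, h0.2]
      have body : ∀ u v, (0 ≤ u ∧ u < 4 * r + 6 ∧ 0 ≤ v ∧ v < 4 * r + 6) →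
          ¬ coarseSlot r u v → ¬ coarseSlot r v u → coarseShape r u v :=
        fun u v h h' h'' => Or.inl ⟨h.1, h.2.1, h.2.2.1, h.2.2.2, h', h''⟩
      by_cases h1 : coarseSlot r (x - (4 * r + 6)) y
      · have h1' := h1
        unfold coarseSlot at h1'
        -- Residue 1 is the hook of a tooth. The path leaves it upwards and then goes two squares
        -- west: one step away from the centre at worst, two towards it.
        by_cases h2 : (y - r - 2) % 3 = 1
        · have a1 : coarseShape r x (y + 1) := Or.inr (Or.inl (by unfold coarseSlot; omega))
          have a2 : coarseShape r (x - 1) (y + 1) := by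
            refine Or.inr (Or.inl ?_); unfold coarseSlot; omega
          have a3 : coarseShape r (x - 1 - 1) (y + 1) := by
            by_cases hr1 : r = 1
            · refine body _ _ ?_ ?_ ?_ <;> (try unfold coarseSlot) <;> omega
            · refine Or.inr (Or.inl ?_); unfold coarseSlot; omega
          rw [north x y h a1, west x _ a1 a2, west _ _ a2 a3]
          exact ih _ _ (by omega) a3
        · have a1 : coarseShape r (x - 1) y := by
            by_cases hx0 : x = 4 * r + 6
            · refine body _ _ ?_ ?_ ?_ <;> (try unfold coarseSlot) <;> omega
            · refine Or.inr (Or.inl ?_); unfold coarseSlot; omega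
          rw [west x y h a1]
          exact ih _ _ (by omega) a1
      by_cases h1' : coarseSlot r (y - (4 * r + 6)) x
      · have h2' := h1'
        unfold coarseSlot at h2'
        by_cases h2 : (x - r - 2) % 3 = 1
        · have a1 : coarseShape r (x + 1) y := Or.inr (Or.inr (by unfold coarseSlot; omega))
          have a2 : coarseShape r (x + 1) (y - 1) := by
            refine Or.inr (Or.inr ?_); unfold coarseSlot; omega
          have a3 : coarseShape r (x + 1) (y - 1 - 1) := by
            by_cases hr1 : r = 1
            · refine body _ _ ?_ ?_ ?_ <;> (try unfold coarseSlot) <;> omega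
            · refine Or.inr (Or.inr ?_); unfold coarseSlot; omega
          rw [east x y h a1, south _ _ a1 a2, south _ _ a2 a3]
          exact ih _ _ (by omega) a3
        · have a1 : coarseShape r x (y - 1) := by
            by_cases hy0 : y = 4 * r + 6
            · refine body _ _ ?_ ?_ ?_ <;> (try unfold coarseSlot) <;> omega
            · refine Or.inr (Or.inr ?_); unfold coarseSlot; omega
          rw [south x y h a1]
          exact ih _ _ (by omega) a1
      obtain ⟨b1, b2, b3, b4, b5, b6⟩ : 0 ≤ x ∧ x < 4 * r + 6 ∧ 0 ≤ y ∧ y < 4 * r + 6 ∧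
          ¬ coarseSlot r x y ∧ ¬ coarseSlot r y x := by
        unfold coarseShape at h; tauto
      -- A wall between slots is two squares thick, and its row of residue 1 is interrupted by a
      -- hook. The path first moves to the uninterrupted row of residue 0.
      by_cases h2 : x ≤ r ∧ r + 2 ≤ y ∧ y < 4 * r + 2 ∧ (y - r - 2) % 3 = 1
      · have a1 : coarseShape r x (y - 1) := by
          refine body _ _ ?_ ?_ ?_ <;> (try unfold coarseSlot) <;> omega
        rw [south x y h a1]
        exact ih _ _ (by omega) a1
      by_cases h2' : y ≤ r ∧ r + 2 ≤ x ∧ x < 4 * r + 2 ∧ (x - r - 2) % 3 = 1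
      · have a1 : coarseShape r (x - 1) y := by
          refine body _ _ ?_ ?_ ?_ <;> (try unfold coarseSlot) <;> omega
        rw [west x y h a1]
        exact ih _ _ (by omega) a1
      unfold coarseSlot at b5 b6
      by_cases h3 : x < r + 1
      · have a1 : coarseShape r (x + 1) y := by
          refine body _ _ ?_ ?_ ?_ <;> (try unfold coarseSlot) <;> omega
        rw [east x y h a1]
        exact ih _ _ (by omega) a1
      by_cases h4 : y < r + 1
      · have a1 : coarseShape r x (y + 1) := by
          refine body _ _ ?_ ?_ ?_ <;> (try unfold coarseSlot) <;> omega
        rw [north x y h a1]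
        exact ih _ _ (by omega) a1
      clear b5 b6
      by_cases h5 : r + 1 < x
      · have a1 : coarseShape r (x - 1) y := by
          refine body _ _ ?_ ?_ ?_ <;> (try unfold coarseSlot) <;> omega
        rw [west x y h a1]
        exact ih _ _ (by omega) a1
      · have a1 : coarseShape r x (y - 1) := by
          refine body _ _ ?_ ?_ ?_ <;> (try unfold coarseSlot) <;> omega
        rw [south x y h a1]
        exact ih _ _ (by omega) a1
  exact fun x y => main _ x y le_rfl

theorem shape_double {r x y : ℤ} : shape r (2 * x) (2 * y) ↔ coarseShape r x y := by
  rw [shape_iff, show 2 * x / 2 = x by omega, show 2 * y / 2 = y by omega]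

theorem shape_double_succ {r x y : ℤ} : shape r (2 * x) (2 * y + 1) ↔ coarseShape r x y := by
  rw [shape_iff, show 2 * x / 2 = x by omega, show (2 * y + 1) / 2 = y by omega]

theorem shape_succ_double {r x y : ℤ} : shape r (2 * x + 1) (2 * y) ↔ coarseShape r x y := by
  rw [shape_iff, show (2 * x + 1) / 2 = x by omega, show 2 * y / 2 = y by omega]

theorem shape_succ_succ {r x y : ℤ} : shape r (2 * x + 1) (2 * y + 1) ↔ coarseShape r x y := by
  rw [shape_iff, show (2 * x + 1) / 2 = x by omega, show (2 * y + 1) / 2 = y by omega]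

/-- The edge starting at `e.1` in direction `e.2` leaves `A` and lies inside the macrotile. -/
def InnerCrossing (r : ℤ) (A : Set (ℤ × ℤ)) (e : (ℤ × ℤ) × Dir) : Prop :=
  shape r e.1.1 e.1.2 ∧ shape r (e.1 + e.2.vec).1 (e.1 + e.2.vec).2 ∧ e.1 ∈ A ∧ e.1 + e.2.vec ∉ A

theorem InnerCrossing.mk' {r : ℤ} {A : Set (ℤ × ℤ)} {x y u v : ℤ} {d : Dir}
    (hv : (x, y) + d.vec = (u, v)) (hs : shape r x y) (hs' : shape r u v) (h : (x, y) ∈ A)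
    (h' : (u, v) ∉ A) : InnerCrossing r A ((x, y), d) := by
  unfold InnerCrossing
  dsimp only
  rw [hv]
  exact ⟨hs, hs', h, h'⟩

/-- A walk around a 4-cycle that meets both `A` and its complement leaves `A` at least once in
either orientation, and an edge used counterclockwise differs from one used clockwise. -/
theorem square_crossings {r : ℤ} {A : Set (ℤ × ℤ)} {x y : ℤ} (h : coarseShape r x y)
    (hA : ¬ (((2 * x, 2 * y) ∈ A ↔ (2 * x + 1, 2 * y) ∈ A) ∧
      ((2 * x, 2 * y) ∈ A ↔ (2 * x + 1, 2 * y + 1) ∈ A) ∧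
      ((2 * x, 2 * y) ∈ A ↔ (2 * x, 2 * y + 1) ∈ A))) :
    ∃ e₁ e₂, e₁ ≠ e₂ ∧ InnerCrossing r A e₁ ∧ InnerCrossing r A e₂ := by
  have h0 := shape_double.2 h
  have h1 := shape_succ_double.2 h
  have h2 := shape_succ_succ.2 h
  have h3 := shape_double_succ.2 h
  have forward : ∃ e, InnerCrossing r A e ∧
      (e = ((2 * x, 2 * y), Dir.east) ∨ e = ((2 * x + 1, 2 * y), Dir.north) ∨
        e = ((2 * x + 1, 2 * y + 1), Dir.west) ∨ e = ((2 * x, 2 * y + 1), Dir.south)) := by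
    have : ((2 * x, 2 * y) ∈ A ∧ (2 * x + 1, 2 * y) ∉ A) ∨
        ((2 * x + 1, 2 * y) ∈ A ∧ (2 * x + 1, 2 * y + 1) ∉ A) ∨
        ((2 * x + 1, 2 * y + 1) ∈ A ∧ (2 * x, 2 * y + 1) ∉ A) ∨
        ((2 * x, 2 * y + 1) ∈ A ∧ (2 * x, 2 * y) ∉ A) := by tauto
    rcases this with k | k | k | k
    · exact ⟨_, .mk' (by simp [Dir.vec]) h0 h1 k.1 k.2, .inl rfl⟩
    · exact ⟨_, .mk' (by simp [Dir.vec]) h1 h2 k.1 k.2, .inr (.inl rfl)⟩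
    · exact ⟨_, .mk' (by simp [Dir.vec]) h2 h3 k.1 k.2, .inr (.inr (.inl rfl))⟩
    · exact ⟨_, .mk' (by simp [Dir.vec]) h3 h0 k.1 k.2, .inr (.inr (.inr rfl))⟩
  have backward : ∃ e, InnerCrossing r A e ∧
      (e = ((2 * x + 1, 2 * y), Dir.west) ∨ e = ((2 * x + 1, 2 * y + 1), Dir.south) ∨
        e = ((2 * x, 2 * y + 1), Dir.east) ∨ e = ((2 * x, 2 * y), Dir.north)) := by
    have : ((2 * x + 1, 2 * y) ∈ A ∧ (2 * x, 2 * y) ∉ A) ∨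
        ((2 * x + 1, 2 * y + 1) ∈ A ∧ (2 * x + 1, 2 * y) ∉ A) ∨
        ((2 * x, 2 * y + 1) ∈ A ∧ (2 * x + 1, 2 * y + 1) ∉ A) ∨
        ((2 * x, 2 * y) ∈ A ∧ (2 * x, 2 * y + 1) ∉ A) := by tauto
    rcases this with k | k | k | k
    · exact ⟨_, .mk' (by simp [Dir.vec]) h1 h0 k.1 k.2, .inl rfl⟩
    · exact ⟨_, .mk' (by simp [Dir.vec]) h2 h1 k.1 k.2, .inr (.inl rfl)⟩
    · exact ⟨_, .mk' (by simp [Dir.vec]) h3 h2 k.1 k.2, .inr (.inr (.inl rfl))⟩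
    · exact ⟨_, .mk' (by simp [Dir.vec]) h0 h3 k.1 k.2, .inr (.inr (.inr rfl))⟩
  obtain ⟨e₁, c₁, l₁⟩ := forward
  obtain ⟨e₂, c₂, l₂⟩ := backward
  refine ⟨e₁, e₂, ?_, c₁, c₂⟩
  rcases l₁ with rfl | rfl | rfl | rfl <;> rcases l₂ with rfl | rfl | rfl | rfl <;> simp

/-- Every cut of a macrotile cuts at least two of its inner edges. -/
theorem exists_two_crossings {r : ℤ} (hr : 1 ≤ r) {A : Set (ℤ × ℤ)} {a b : ℤ × ℤ}
    (ha : shape r a.1 a.2) (haA : a ∈ A) (hb : shape r b.1 b.2) (hbA : b ∉ A) :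
    ∃ e₁ e₂, e₁ ≠ e₂ ∧ InnerCrossing r A e₁ ∧ InnerCrossing r A e₂ := by
  by_contra hne
  have hsq : ∀ x y, coarseShape r x y →
      (((2 * x, 2 * y) ∈ A ↔ (2 * x + 1, 2 * y) ∈ A) ∧
      ((2 * x, 2 * y) ∈ A ↔ (2 * x + 1, 2 * y + 1) ∈ A) ∧
      ((2 * x, 2 * y) ∈ A ↔ (2 * x, 2 * y + 1) ∈ A)) := by
    intro x y h
    by_contra h'
    exact hne (square_crossings h h')
  have hcell : ∀ x y, shape r x y →
      coarseShape r (x / 2) (y / 2) ∧ ((x, y) ∈ A ↔ (2 * (x / 2), 2 * (y / 2)) ∈ A) := by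
    intro x y h
    have h' := shape_iff.1 h
    refine ⟨h', ?_⟩
    obtain ⟨k1, k2, k3⟩ := hsq _ _ h'
    rcases Int.emod_two_eq_zero_or_one x with ex | ex <;>
      rcases Int.emod_two_eq_zero_or_one y with ey | ey
    · rw [show 2 * (x / 2) = x by omega, show 2 * (y / 2) = y by omega]
    · rw [k3, show 2 * (x / 2) = x by omega, show 2 * (y / 2) + 1 = y by omega]
    · rw [k1, show 2 * (x / 2) + 1 = x by omega, show 2 * (y / 2) = y by omega]
    · rw [k2, show 2 * (x / 2) + 1 = x by omega, show 2 * (y / 2) + 1 = y by omega]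
  -- Membership in `A` is constant on each square. If two adjacent squares disagreed, the two
  -- parallel edges between them would both cross; so it is constant on the whole shape.
  have hcon := coarseShape_connected hr (fun x y => (2 * x, 2 * y) ∈ A) ?_ ?_
  · obtain ⟨sa, ea⟩ := hcell _ _ ha
    obtain ⟨sb, eb⟩ := hcell _ _ hb
    exact hbA (eb.2 ((hcon _ _ sb).2 ((hcon _ _ sa).1 (ea.1 haA))))
  · intro x y h h'
    obtain ⟨k1, k2, k3⟩ := hsq _ _ h
    obtain ⟨l1, l2, l3⟩ := hsq _ _ h'
    have s1 := shape_succ_double.2 h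
    have s2 := shape_succ_succ.2 h
    have s3 := shape_double.2 h'
    have s4 := shape_double_succ.2 h'
    have e : 2 * x + 1 + 1 = 2 * (x + 1) := by ring
    have e' : 2 * (x + 1) + -1 = 2 * x + 1 := by ring
    by_contra hd
    by_cases hA : (2 * x, 2 * y) ∈ A
    · have hB : (2 * (x + 1), 2 * y) ∉ A := fun h => hd (by simp [hA, h])
      exact hne ⟨((2 * x + 1, 2 * y), Dir.east), ((2 * x + 1, 2 * y + 1), Dir.east), by simp,
        .mk' (by simp [Dir.vec, e]) s1 s3 (k1.1 hA) hB,
        .mk' (by simp [Dir.vec, e]) s2 s4 (k2.1 hA) (mt l3.2 hB)⟩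
    · have hB : (2 * (x + 1), 2 * y) ∈ A := by
        by_contra h
        exact hd (by simp [hA, h])
      exact hne ⟨((2 * (x + 1), 2 * y), Dir.west), ((2 * (x + 1), 2 * y + 1), Dir.west), by simp,
        .mk' (by simp [Dir.vec, e']) s3 s1 hB (mt k1.2 hA),
        .mk' (by simp [Dir.vec, e']) s4 s2 (l3.1 hB) (mt k2.2 hA)⟩
  · intro x y h h'
    obtain ⟨k1, k2, k3⟩ := hsq _ _ h
    obtain ⟨l1, l2, l3⟩ := hsq _ _ h'
    have s1 := shape_double_succ.2 h
    have s2 := shape_succ_succ.2 h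
    have s3 := shape_double.2 h'
    have s4 := shape_succ_double.2 h'
    have e : 2 * y + 1 + 1 = 2 * (y + 1) := by ring
    have e' : 2 * (y + 1) + -1 = 2 * y + 1 := by ring
    by_contra hd
    by_cases hA : (2 * x, 2 * y) ∈ A
    · have hB : (2 * x, 2 * (y + 1)) ∉ A := fun h => hd (by simp [hA, h])
      exact hne ⟨((2 * x, 2 * y + 1), Dir.north), ((2 * x + 1, 2 * y + 1), Dir.north), by simp,
        .mk' (by simp [Dir.vec, e]) s1 s3 (k3.1 hA) hB,
        .mk' (by simp [Dir.vec, e]) s2 s4 (k2.1 hA) (mt l1.2 hB)⟩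
    · have hB : (2 * x, 2 * (y + 1)) ∈ A := by
        by_contra h
        exact hd (by simp [hA, h])
      exact hne ⟨((2 * x, 2 * (y + 1)), Dir.south), ((2 * x + 1, 2 * (y + 1)), Dir.south),
        by simp,
        .mk' (by simp [Dir.vec, e']) s3 s1 hB (mt k3.2 hA),
        .mk' (by simp [Dir.vec, e']) s4 s2 (l1.1 hB) (mt k2.2 hA)⟩

/-! ### The tiles of a macrotile -/

/-- The side on the other axis: the glue on side `d` of a tile is represented by pads on the sides
`d.flip` of the tiles of its macrotile. -/
def Dir.flip : Dir → Dir
  | .north => .east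
  | .east => .north
  | .south => .west
  | .west => .south

@[simp] theorem Dir.flip_flip (d : Dir) : d.flip.flip = d := by cases d <;> rfl

@[simp] theorem Dir.opp_opp (d : Dir) : d.opp.opp = d := by cases d <;> rfl

@[simp] theorem Dir.flip_opp (d : Dir) : d.opp.flip = d.flip.opp := by cases d <;> rfl

@[simp] theorem Dir.vec_opp (d : Dir) : d.opp.vec = -d.vec := by cases d <;> rfl

theorem Dir.vec_ne_zero (d : Dir) : d.vec ≠ 0 := by cases d <;> simp [Dir.vec]

theorem Dir.vec_injective : Function.Injective Dir.vec := by
  intro d d' h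
  cases d <;> cases d' <;> simp_all [Dir.vec]

/-- Pairwise different labels. -/
noncomputable def label (n : ℕ) : String := Infinite.natEmbedding String n

theorem label_inj {a b : ℕ} : label a = label b ↔ a = b :=
  (Infinite.natEmbedding String).injective.eq_iff

/-- The glue on the boundary of a macrotile outside of the pads. -/
noncomputable def blankGlue : Glue := ⟨label 0, 0⟩

/-- The glue on the pads; only the active ones bind. -/
noncomputable def padGlue (active : Bool) : Glue := ⟨label 1, if active then 1 else 0⟩

/-- The glue that marks the south-west corner of a macrotile. -/
noncomputable def cornerGlue : Glue := ⟨label 2, 0⟩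

/-- The glues in the interior of a macrotile, which bind with strength `h`. -/
noncomputable def innerGlue (h : ℕ) (b : Bool) : Glue := ⟨label (if b then 4 else 3), h⟩

theorem innerGlue_injective {h : ℕ} {b b' : Bool} (e : innerGlue h b = innerGlue h b') :
    b = b' := by
  simp only [innerGlue, Glue.mk.injEq, label_inj] at e
  cases b <;> cases b' <;> simp_all

/-- The glues of the universal tile set. -/
noncomputable def palette (h : ℕ) : List Glue :=
  [blankGlue, padGlue true, padGlue false, cornerGlue, innerGlue h true, innerGlue h false]

/-- The data from which macrotiles are built: a size `r`, a temperature, and for every glue `g` of a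
set of glues the positions `pos g j`, `j < temp`, of its pads. -/
structure Code where
  r : ℤ
  one_le : 1 ≤ r
  temp : ℕ
  two_le : 2 ≤ temp
  glueSet : Set Glue
  pos : Glue → ℕ → ℤ × ℤ
  pos_range : ∀ g ∈ glueSet, ∀ j < temp, PadRange r (pos g j).1 (pos g j).2
  pos_inj : ∀ g ∈ glueSet, ∀ j < temp, ∀ g' ∈ glueSet, ∀ j' < temp, pos g j = pos g' j' →
    g = g' ∧ j = j'

namespace Code

variable (C : Code)

/-- The strength of the glues in the interior of macrotiles. -/
def innerStrength : ℕ := (C.temp + 1) / 2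

/-- Half of the temperature, rounded up, is below `temp` because `temp` is at least 2: one inner
edge cannot hold a tile, two can. -/
theorem innerStrength_lt : C.innerStrength < C.temp := by
  have := C.two_le; unfold innerStrength; omega

theorem le_two_mul_innerStrength : C.temp ≤ 2 * C.innerStrength := by
  unfold innerStrength; omega

/-- The cells of a macrotile. -/
def Mem (x : ℤ × ℤ) : Prop := shape C.r x.1 x.2

/-- The south-west corner of the block with index `p`. -/
def base (p : ℤ × ℤ) : ℤ × ℤ := ((8 * C.r + 12) * p.1, (8 * C.r + 12) * p.2)

/-- The index of the macrotile that covers a cell. -/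
noncomputable def own (x : ℤ × ℤ) : ℤ × ℤ := owner C.r x.1 x.2

theorem base_add (p q : ℤ × ℤ) : C.base (p + q) = C.base p + C.base q := by
  ext <;> simp [base, mul_add]

theorem base_sub (p q : ℤ × ℤ) : C.base (p - q) = C.base p - C.base q := by
  ext <;> simp [base, mul_sub]

theorem base_zero : C.base 0 = 0 := by ext <;> simp [base]

theorem base_injective : Function.Injective C.base := by
  intro p q h
  have := C.one_le
  simp only [base, Prod.mk.injEq] at h
  have h0 : (8 * C.r + 12) ≠ 0 := by omega
  exact Prod.ext (mul_left_cancel₀ h0 h.1) (mul_left_cancel₀ h0 h.2)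

theorem own_eq_iff {x p : ℤ × ℤ} : C.own x = p ↔ C.Mem (x - C.base p) := owner_eq_iff C.one_le _ _ _

theorem mem_sub_base (x : ℤ × ℤ) : C.Mem (x - C.base (C.own x)) := C.own_eq_iff.1 rfl

theorem own_add_base {x p : ℤ × ℤ} (h : C.Mem x) : C.own (x + C.base p) = p := by
  rw [own_eq_iff, add_sub_cancel_right]; exact h

theorem mem_iff {x : ℤ × ℤ} : C.Mem x ↔ C.own x = 0 := by
  rw [own_eq_iff, base_zero, sub_zero]

theorem own_sub (x p : ℤ × ℤ) : C.own (x - C.base p) = C.own x - p := by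
  rw [own_eq_iff, base_sub, sub_sub_sub_cancel_right]; exact C.mem_sub_base x

open Classical in
/-- The glue at the pad position `y` that represents the glue `g`. -/
noncomputable def content (g : Glue) (y : ℤ × ℤ) : Glue :=
  if g ∈ C.glueSet ∧ ∃ j < C.temp, C.pos g j = y then
    padGlue (decide (∃ j < C.temp, j < g.strength ∧ C.pos g j = y))
  else blankGlue

/-- The pad position of the cell `x`, for its side `d`. -/
def padIndex : Dir → ℤ × ℤ → ℤ × ℤ
  | .north, x => (x.1 - (8 * C.r + 12), x.2 - (2 * C.r + 9))
  | .south, x => (x.1, x.2 - (2 * C.r + 10))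
  | .east, x => (x.2 - (8 * C.r + 12), x.1 - (2 * C.r + 9))
  | .west, x => (x.2, x.1 - (2 * C.r + 10))

/-- The cell whose side `d` has the pad position `y`. -/
def padCell : Dir → ℤ × ℤ → ℤ × ℤ
  | .north, y => (y.1 + (8 * C.r + 12), y.2 + (2 * C.r + 9))
  | .south, y => (y.1, y.2 + (2 * C.r + 10))
  | .east, y => (y.2 + (2 * C.r + 9), y.1 + (8 * C.r + 12))
  | .west, y => (y.2 + (2 * C.r + 10), y.1)

theorem padCell_eq_iff {d : Dir} {x y : ℤ × ℤ} : C.padCell d y = x ↔ y = C.padIndex d x := by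
  cases d <;> simp only [padCell, padIndex, Prod.ext_iff] <;> omega

theorem padCell_padIndex (d : Dir) (x : ℤ × ℤ) : C.padCell d (C.padIndex d x) = x :=
  C.padCell_eq_iff.2 rfl

theorem padIndex_padCell (d : Dir) (y : ℤ × ℤ) : C.padIndex d (C.padCell d y) = y :=
  (C.padCell_eq_iff.1 rfl).symm

/-- Crossing the face of a pad leads to the same pad position on the opposite face of the lattice
neighbour. This is why correctly placed macrotiles meet pad on pad. -/
theorem padCell_add_vec (d : Dir) (y : ℤ × ℤ) :
    C.padCell d y + d.vec = C.padCell d.opp y + C.base d.flip.vec := by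
  cases d <;>
    simp only [padCell, Dir.vec, Dir.opp, Dir.flip, base, Prod.mk_add_mk, Prod.mk.injEq] <;>
    constructor <;> ring

theorem mem_padCell {y : ℤ × ℤ} (h : PadRange C.r y.1 y.2) (d : Dir) : C.Mem (C.padCell d y) := by
  cases d
  · exact shape_tooth h
  · exact shape_swap.1 (shape_tooth h)
  · exact shape_ceiling h
  · exact shape_swap.1 (shape_ceiling h)

/-- The offsets of the regions that record the glues on the four sides. -/
def recordOffset : Dir → ℤ × ℤ
  | .north => (2 * C.r + 2, 2 * C.r + 2)
  | .east => (3 * C.r + 2, 2 * C.r + 2)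
  | .south => (4 * C.r + 2, 2 * C.r + 2)
  | .west => (5 * C.r + 2, 2 * C.r + 2)

/-- The interior of the macrotile of `t` records the glues of `t`. -/
def Recorded (t : Tile) (x : ℤ × ℤ) : Prop := ∃ d, x = C.pos (t d) 0 + C.recordOffset d

open Classical in
/-- The glue on side `d` of the cell `x` of the macrotile of `t`, if this side is interior. -/
noncomputable def innerSide (t : Tile) (x : ℤ × ℤ) : Dir → Glue
  | .north => innerGlue C.innerStrength (decide (C.Recorded t x))
  | .south => innerGlue C.innerStrength (decide (C.Recorded t (x + Dir.south.vec)))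
  | .east => innerGlue C.innerStrength false
  | .west => innerGlue C.innerStrength false

open Classical in
/-- The glue on side `d` of the cell `x` of the macrotile of `t`, if this side is exposed. -/
noncomputable def outerSide (t : Tile) (x : ℤ × ℤ) (d : Dir) : Glue :=
  if d = .west ∧ x = 0 then cornerGlue else C.content (t d.flip) (C.padIndex d x)

open Classical in
/-- The tile in the cell `x` of the macrotile of `t`. -/
noncomputable def side (t : Tile) (x : ℤ × ℤ) (d : Dir) : Glue :=
  if C.Mem (x + d.vec) then C.innerSide t x d else C.outerSide t x d

theorem innerSide_strength (t : Tile) (x : ℤ × ℤ) (d : Dir) :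
    (C.innerSide t x d).strength = C.innerStrength := by cases d <;> rfl

theorem innerSide_opp (t : Tile) (x : ℤ × ℤ) (d : Dir) :
    C.innerSide t (x + d.vec) d.opp = C.innerSide t x d := by
  have h : x + Dir.north.vec + Dir.south.vec = x := by ext <;> simp [Dir.vec]
  cases d
  · exact congrArg (innerGlue _) (decide_eq_decide.2 (by rw [h]))
  all_goals rfl

theorem side_of_mem {t : Tile} {x : ℤ × ℤ} {d : Dir} (h : C.Mem (x + d.vec)) :
    C.side t x d = C.innerSide t x d := if_pos h

theorem side_of_not_mem {t : Tile} {x : ℤ × ℤ} {d : Dir} (h : ¬ C.Mem (x + d.vec)) :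
    C.side t x d = C.outerSide t x d := if_neg h

/-- The corner mark, the blank glue and inactive pads all have strength 0, so a positive strength
singles out an active pad. -/
theorem outerSide_of_pos {t : Tile} {x : ℤ × ℤ} {d : Dir} (h : 0 < (C.outerSide t x d).strength) :
    C.outerSide t x d = padGlue true ∧ t d.flip ∈ C.glueSet ∧
      ∃ j < C.temp, j < (t d.flip).strength ∧ x = C.padCell d (C.pos (t d.flip) j) := by
  unfold outerSide at *
  split_ifs at h with h1
  · simp [cornerGlue] at h
  rw [if_neg h1]
  unfold content at *
  split_ifs at h with h2
  · rw [if_pos h2]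
    by_cases h3 : ∃ j < C.temp, j < (t d.flip).strength ∧ C.pos (t d.flip) j = C.padIndex d x
    · obtain ⟨j, j1, j2, j3⟩ := h3
      refine ⟨by rw [decide_eq_true]; exact ⟨j, j1, j2, j3⟩, h2.1, j, j1, j2, ?_⟩
      rw [j3, padCell_padIndex]
    · simp [padGlue, h3] at h
  · simp [blankGlue] at h

/-- No cell of a macrotile carries pads on two of its sides. -/
theorem padCell_dir {y y' : ℤ × ℤ} (h : PadRange C.r y.1 y.2) (h' : PadRange C.r y'.1 y'.2)
    {d d' : Dir} (e : C.padCell d y = C.padCell d' y') : d = d' := by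
  unfold PadRange at h h'
  have := C.one_le
  cases d <;> cases d' <;> simp only [padCell, Prod.ext_iff] at e <;> first | rfl | omega

/-- Two tiles of disjoint macrotiles bind only through the pads that represent a common glue of two
tiles that abut; in particular the macrotiles are aligned. -/
theorem contact {s t : Tile} {x w : ℤ × ℤ} {d : Dir} (hx : C.Mem x) (hy : C.Mem (x + d.vec - w))
    (hd : ∀ z, C.Mem z → ¬ C.Mem (z - w)) (he : C.side s x d = C.side t (x + d.vec - w) d.opp)
    (hpos : 0 < (C.side s x d).strength) :
    w = C.base d.flip.vec ∧ s d.flip = t d.flip.opp ∧ C.side s x d = padGlue true ∧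
      s d.flip ∈ C.glueSet ∧ ∃ j < C.temp, j < (s d.flip).strength ∧
        x = C.padCell d (C.pos (s d.flip) j) := by
  have hpos' := hpos
  rw [he] at hpos'
  -- Disjointness makes the common face exposed on both sides, so the bond joins two active pads.
  have n1 : ¬ C.Mem (x + d.vec) := fun h => hd _ h hy
  have n2 : ¬ C.Mem (x + d.vec - w + d.opp.vec) := by
    rw [Dir.vec_opp, show x + d.vec - w + -d.vec = x - w by abel]
    exact hd x hx
  rw [C.side_of_not_mem n1] at hpos ⊢
  rw [C.side_of_not_mem n2] at hpos'
  obtain ⟨e1, g1, j, j1, j2, j3⟩ := C.outerSide_of_pos hpos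
  obtain ⟨e2, g2, j', j1', j2', j3'⟩ := C.outerSide_of_pos hpos'
  rw [Dir.flip_opp] at *
  have r1 := C.pos_range _ g1 _ j1
  have r2 := C.pos_range _ g2 _ j1'
  -- The four directions reduce to one: reflection in the diagonal handles east and west, and for
  -- south and west the two macrotiles exchange the roles of tooth and slot.
  have hyy : C.pos (s d.flip) j = C.pos (t d.flip.opp) j' := by
    generalize C.pos (s d.flip) j = y at *
    generalize C.pos (t d.flip.opp) j' = y' at *
    subst j3
    cases d
    · refine Prod.ext_iff.2 (pads_aligned r1 r2 ?_)
      simp only [padCell, Dir.vec, Dir.opp, Prod.ext_iff, Prod.fst_sub, Prod.snd_sub,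
        Prod.fst_add, Prod.snd_add] at j3'
      intro a b hab hab'
      apply hd (a, b) hab
      unfold Mem
      convert hab' using 1 <;> simp only [Prod.fst_sub, Prod.snd_sub] <;> omega
    · refine Prod.ext_iff.2 (pads_aligned r1 r2 ?_)
      simp only [padCell, Dir.vec, Dir.opp, Prod.ext_iff, Prod.fst_sub, Prod.snd_sub,
        Prod.fst_add, Prod.snd_add] at j3'
      intro a b hab hab'
      apply hd (b, a) (shape_swap.1 hab)
      rw [shape_swap] at hab'
      unfold Mem
      convert hab' using 1 <;> simp only [Prod.fst_sub, Prod.snd_sub] <;> omega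
    · refine (Prod.ext_iff.2 (pads_aligned r2 r1 ?_)).symm
      simp only [padCell, Dir.vec, Dir.opp, Prod.ext_iff, Prod.fst_sub, Prod.snd_sub,
        Prod.fst_add, Prod.snd_add] at j3'
      intro a b hab hab'
      refine hd (_, _) hab' ?_
      unfold Mem
      convert hab using 1 <;> simp only [Prod.fst_sub, Prod.snd_sub] <;> omega
    · refine (Prod.ext_iff.2 (pads_aligned r2 r1 ?_)).symm
      simp only [padCell, Dir.vec, Dir.opp, Prod.ext_iff, Prod.fst_sub, Prod.snd_sub,
        Prod.fst_add, Prod.snd_add] at j3'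
      intro a b hab hab'
      rw [shape_swap] at hab hab'
      refine hd (_, _) hab' ?_
      unfold Mem
      convert hab using 1 <;> simp only [Prod.fst_sub, Prod.snd_sub] <;> omega
  refine ⟨?_, (C.pos_inj _ g1 _ j1 _ g2 _ j1' hyy).1, e1, g1, j, j1, j2, j3⟩
  -- Equal pad positions on opposite faces force the displacement of a lattice neighbour, by
  -- `padCell_add_vec`.
  rw [← hyy, j3, padCell_add_vec, sub_eq_iff_eq_add, add_right_inj] at j3'
  exact j3'.symm

end Code

/-! ### Bonds -/

theorem bond_of_eq_some {α : Assembly} {x : ℤ × ℤ} {d : Dir} {s t : Tile} (hs : α x = some s)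
    (ht : α (x + d.vec) = some t) (h : s d = t d.opp) : bond α x d = (s d).strength := by
  simp [bond, hs, ht, h]

theorem exists_of_bond_pos {α : Assembly} {x : ℤ × ℤ} {d : Dir} (h : 0 < bond α x d) :
    ∃ s t, α x = some s ∧ α (x + d.vec) = some t ∧ s d = t d.opp ∧
      bond α x d = (s d).strength := by
  have h' := h
  unfold bond at h'
  split at h'
  · next s t hs ht =>
    split_ifs at h' with he
    · exact ⟨s, t, hs, ht, he, bond_of_eq_some hs ht he⟩
    · simp at h'
  · simp at h'

theorem mem_dom {α : Assembly} {x : ℤ × ℤ} : x ∈ dom α ↔ ∃ t, α x = some t :=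
  Option.ne_none_iff_exists'

theorem translate_apply (u : ℤ × ℤ) (α : Assembly) (x : ℤ × ℤ) : translate u α x = α (x - u) := rfl

theorem translate_zero (α : Assembly) : translate 0 α = α := by
  funext x; simp [translate]

theorem translate_translate (u v : ℤ × ℤ) (α : Assembly) :
    translate u (translate v α) = translate (u + v) α := by
  funext x; simp only [translate]; congr 1; abel

theorem translate_union (u : ℤ × ℤ) (α β : Assembly) :
    translate u (union α β) = union (translate u α) (translate u β) := rfl

theorem mem_dom_translate {u x : ℤ × ℤ} {α : Assembly} :
    x ∈ dom (translate u α) ↔ x - u ∈ dom α := Iff.rfl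

theorem bond_translate (u : ℤ × ℤ) (α : Assembly) (x : ℤ × ℤ) (d : Dir) :
    bond (translate u α) x d = bond α (x - u) d := by
  unfold bond
  rw [translate_apply, translate_apply, show x + d.vec - u = x - u + d.vec by abel]

theorem union_eq_some {α β : Assembly} (h : Disjoint (dom α) (dom β)) {x : ℤ × ℤ} {t : Tile} :
    union α β x = some t ↔ α x = some t ∨ β x = some t := by
  unfold union
  rcases hα : α x with _ | s
  · simp
  · rcases hβ : β x with _ | s'
    · simp
    · exact absurd (mem_dom.2 ⟨_, hβ⟩) (Set.disjoint_left.1 h (mem_dom.2 ⟨_, hα⟩))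

theorem dom_union (α β : Assembly) : dom (union α β) = dom α ∪ dom β := by
  ext x
  simp only [dom, union, Set.mem_ofPred_eq, Set.mem_union]
  rcases hα : α x with _ | s <;> simp

theorem union_comm {α β : Assembly} (h : Disjoint (dom α) (dom β)) : union α β = union β α := by
  funext x
  ext t
  rw [union_eq_some h, union_eq_some h.symm, or_comm]

/-- Bonds between cells of the first part do not change if something is attached. -/
theorem bond_le_of_le {α β : Assembly} (h : ∀ x t, α x = some t → β x = some t) (x : ℤ × ℤ)
    (d : Dir) : bond α x d ≤ bond β x d := by
  rcases Nat.eq_zero_or_pos (bond α x d) with h0 | h0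
  · omega
  · obtain ⟨s, t, hs, ht, he, hb⟩ := exists_of_bond_pos h0
    rw [hb, bond_of_eq_some (h _ _ hs) (h _ _ ht) he]

theorem Stable.translate {τ : ℕ} {α : Assembly} (h : Stable τ α) (u : ℤ × ℤ) :
    Stable τ (translate u α) := by
  classical
  rintro A ⟨a, ha, haA⟩ ⟨b, hb, hbA⟩
  obtain ⟨F, hF, hs⟩ := h {x | x + u ∈ A} ⟨a - u, ha, by simpa using haA⟩
    ⟨b - u, hb, by simpa using hbA⟩
  refine ⟨F.image fun e => (e.1 + u, e.2), ?_, ?_⟩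
  · intro e he
    obtain ⟨e', he', rfl⟩ := Finset.mem_image.1 he
    have := hF e' he'
    simp only [Set.mem_ofPred_eq] at this
    dsimp only
    rwa [show e'.1 + u + e'.2.vec = e'.1 + e'.2.vec + u by abel]
  · rw [Finset.sum_image]
    · simpa [bond_translate] using hs
    · rintro ⟨a, b⟩ _ ⟨a', b'⟩ _ h
      simpa using h

theorem stable_translate_iff {τ : ℕ} {α : Assembly} {u : ℤ × ℤ} :
    Stable τ (translate u α) ↔ Stable τ α := by
  refine ⟨fun h => ?_, fun h => h.translate u⟩
  have := h.translate (-u)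
  rwa [translate_translate, neg_add_cancel, translate_zero] at this

theorem disjoint_translate_iff {α β : Assembly} {u : ℤ × ℤ} :
    Disjoint (dom (translate u α)) (dom (translate u β)) ↔ Disjoint (dom α) (dom β) := by
  simp only [Set.disjoint_left, mem_dom_translate]
  constructor
  · intro h x hx
    simpa using @h (x + u) (by simpa using hx)
  · intro h x hx
    exact h hx

/-! ### The universal tile set -/

instance : DecidableEq Dir := fun a b => by
  cases a <;> cases b <;> first | exact isTrue rfl | exact isFalse nofun

instance : Fintype Dir := ⟨{.north, .east, .south, .west}, by intro d; cases d <;> simp⟩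

theorem card_dir : Fintype.card Dir = 4 := rfl

open Classical in
/-- The universal tile set: all tiles over the palette with at most one active pad. -/
noncomputable def universalTiles (h : ℕ) : Finset Tile :=
  (Fintype.piFinset fun _ : Dir => (palette h).toFinset).filter fun t =>
    ∀ d d', t d = padGlue true → t d' = padGlue true → d = d'

theorem card_universalTiles_le (h : ℕ) : (universalTiles h).card ≤ 6 ^ 4 := by
  classical
  refine (Finset.card_filter_le _ _).trans ?_
  rw [Fintype.card_piFinset, Finset.prod_const, Finset.card_univ, card_dir]
  exact Nat.pow_le_pow_left (List.toFinset_card_le _) 4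

theorem mem_universalTiles {h : ℕ} {t : Tile} : t ∈ universalTiles h ↔ (∀ d, t d ∈ palette h) ∧
    ∀ d d', t d = padGlue true → t d' = padGlue true → d = d' := by
  simp [universalTiles]

namespace Code

variable (C : Code)

theorem innerGlue_mem_palette (h : ℕ) (b : Bool) : innerGlue h b ∈ palette h := by
  cases b <;> simp [palette]

theorem innerSide_mem_palette (t : Tile) (x : ℤ × ℤ) (d : Dir) :
    C.innerSide t x d ∈ palette C.innerStrength := by
  cases d <;> exact innerGlue_mem_palette _ _

theorem outerSide_mem_palette (t : Tile) (x : ℤ × ℤ) (d : Dir) (h : ℕ) :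
    C.outerSide t x d ∈ palette h := by
  unfold outerSide content
  have : ∀ b, padGlue b ∈ palette h := by intro b; cases b <;> simp [palette]
  split_ifs
  · simp [palette]
  · exact this _
  · simp [palette]

theorem innerSide_ne_padGlue (t : Tile) (x : ℤ × ℤ) (d : Dir) (b : Bool) :
    C.innerSide t x d ≠ padGlue b := by
  have : ∀ c, innerGlue C.innerStrength c ≠ padGlue b := by
    intro c h
    simp only [innerGlue, padGlue, Glue.mk.injEq, label_inj] at h
    cases c <;> simp at h
  cases d <;> exact this _

theorem side_eq_padGlue {t : Tile} {x : ℤ × ℤ} {d : Dir} (h : C.side t x d = padGlue true) :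
    t d.flip ∈ C.glueSet ∧ ∃ j < C.temp, j < (t d.flip).strength ∧
      x = C.padCell d (C.pos (t d.flip) j) := by
  by_cases hm : C.Mem (x + d.vec)
  · rw [C.side_of_mem hm] at h
    exact absurd h (C.innerSide_ne_padGlue _ _ _ _)
  · rw [C.side_of_not_mem hm] at h
    exact (C.outerSide_of_pos (by rw [h]; simp [padGlue])).2

theorem side_mem_universalTiles (t : Tile) (x : ℤ × ℤ) :
    C.side t x ∈ universalTiles C.innerStrength := by
  rw [mem_universalTiles]
  constructor
  · intro d
    unfold side
    split_ifs
    · exact C.innerSide_mem_palette _ _ _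
    · exact C.outerSide_mem_palette _ _ _ _
  · intro d d' h h'
    obtain ⟨g, j, j1, -, j3⟩ := C.side_eq_padGlue h
    obtain ⟨g', j', j1', -, j3'⟩ := C.side_eq_padGlue h'
    exact C.padCell_dir (C.pos_range _ g _ j1) (C.pos_range _ g' _ j1') (j3.symm.trans j3')

/-- The assembly in which every tile is replaced by its macrotile. -/
noncomputable def enlarge (α : Assembly) : Assembly := fun x =>
  (α (C.own x)).map fun t => C.side t (x - C.base (C.own x))

theorem mem_zero : C.Mem 0 := shape_origin C.one_le

theorem own_base (p : ℤ × ℤ) : C.own (C.base p) = p := by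
  have := C.own_add_base (p := p) C.mem_zero
  rwa [zero_add] at this

theorem enlarge_eq_some {α : Assembly} {x : ℤ × ℤ} {u : Tile} :
    C.enlarge α x = some u ↔ ∃ t, α (C.own x) = some t ∧ C.side t (x - C.base (C.own x)) = u := by
  simp [enlarge]

theorem enlarge_add_base (α : Assembly) {x : ℤ × ℤ} (h : C.Mem x) (p : ℤ × ℤ) :
    C.enlarge α (x + C.base p) = (α p).map fun t => C.side t x := by
  unfold enlarge
  rw [C.own_add_base h, add_sub_cancel_right]

theorem mem_dom_enlarge {α : Assembly} {x : ℤ × ℤ} :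
    x ∈ dom (C.enlarge α) ↔ C.own x ∈ dom α := by
  simp [dom, enlarge]

theorem enlarge_translate (w : ℤ × ℤ) (α : Assembly) :
    C.enlarge (translate w α) = translate (C.base w) (C.enlarge α) := by
  funext x
  simp only [enlarge, translate, own_sub, base_sub, sub_sub_sub_cancel_right]

theorem enlarge_union (α β : Assembly) :
    C.enlarge (union α β) = union (C.enlarge α) (C.enlarge β) := by
  funext x
  simp only [enlarge, union]
  cases α (C.own x) <;> rfl

theorem disjoint_enlarge_iff {α β : Assembly} :
    Disjoint (dom (C.enlarge α)) (dom (C.enlarge β)) ↔ Disjoint (dom α) (dom β) := by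
  simp only [Set.disjoint_left, mem_dom_enlarge]
  refine ⟨fun h p hp => ?_, fun h x hx => h hx⟩
  have := @h (C.base p)
  rw [own_base] at this
  exact this hp

theorem isOver_enlarge (α : Assembly) : IsOver (universalTiles C.innerStrength) (C.enlarge α) := by
  intro x u h
  obtain ⟨t, -, rfl⟩ := C.enlarge_eq_some.1 h
  exact C.side_mem_universalTiles _ _

theorem nonempty_dom_enlarge {α : Assembly} (h : (dom α).Nonempty) :
    (dom (C.enlarge α)).Nonempty := by
  obtain ⟨p, hp⟩ := h
  exact ⟨C.base p, by rwa [mem_dom_enlarge, own_base]⟩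

theorem finite_dom_enlarge {α : Assembly} (h : (dom α).Finite) : (dom (C.enlarge α)).Finite := by
  have hB : (Set.Icc (0 : ℤ) (2 * (8 * C.r + 12)) ×ˢ Set.Icc (0 : ℤ) (2 * (8 * C.r + 12))).Finite :=
    (Set.finite_Icc _ _).prod (Set.finite_Icc _ _)
  refine (Set.Finite.image2 (fun z p => z + C.base p) hB h).subset ?_
  intro x hx
  refine ⟨x - C.base (C.own x), ?_, C.own x, C.mem_dom_enlarge.1 hx, by simp⟩
  obtain ⟨h1, h2, h3, h4⟩ := shape_bounds (C.mem_sub_base x)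
  exact ⟨⟨h1, h2.le⟩, ⟨h3, h4.le⟩⟩

/-! ### Bonds in enlarged assemblies -/

theorem bond_enlarge_inner {α : Assembly} {x p : ℤ × ℤ} {d : Dir} (hp : p ∈ dom α) (h : C.Mem x)
    (h' : C.Mem (x + d.vec)) : bond (C.enlarge α) (x + C.base p) d = C.innerStrength := by
  obtain ⟨t, ht⟩ := mem_dom.1 hp
  have e1 := C.enlarge_add_base α h p
  have e2 := C.enlarge_add_base α h' p
  rw [ht, Option.map_some] at e1 e2
  rw [add_right_comm] at e2
  rw [bond_of_eq_some e1 e2, C.side_of_mem h', innerSide_strength]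
  rw [C.side_of_mem h', C.side_of_mem, innerSide_opp]
  rwa [Dir.vec_opp, add_neg_cancel_right]

/-- Different macrotiles of an enlargement are disjoint, so `contact` applies to each edge between
them. -/
theorem bond_enlarge_outer {α : Assembly} {x : ℤ × ℤ} {d : Dir} (hx : C.own (x + d.vec) ≠ C.own x)
    (h : 0 < bond (C.enlarge α) x d) :
    bond (C.enlarge α) x d = 1 ∧ C.own (x + d.vec) = C.own x + d.flip.vec ∧
      ∃ s t, α (C.own x) = some s ∧ α (C.own x + d.flip.vec) = some t ∧ s d.flip = t d.flip.opp ∧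
      ∃ j < C.temp, j < (s d.flip).strength ∧
        x = C.padCell d (C.pos (s d.flip) j) + C.base (C.own x) := by
  obtain ⟨_, _, h1, h2, h3, h4⟩ := exists_of_bond_pos h
  obtain ⟨s, hs, rfl⟩ := C.enlarge_eq_some.1 h1
  obtain ⟨t, ht, rfl⟩ := C.enlarge_eq_some.1 h2
  have ey : x + d.vec - C.base (C.own (x + d.vec)) =
      x - C.base (C.own x) + d.vec - C.base (C.own (x + d.vec) - C.own x) := by
    rw [base_sub]; abel
  have hy := C.mem_sub_base (x + d.vec)
  rw [ey] at h3 hy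
  have hd : ∀ z, C.Mem z → ¬ C.Mem (z - C.base (C.own (x + d.vec) - C.own x)) := by
    intro z hz hz'
    have e1 := C.own_add_base (p := C.own x) hz
    have e2 := C.own_add_base (p := C.own (x + d.vec)) hz'
    rw [base_sub, show z - (C.base (C.own (x + d.vec)) - C.base (C.own x)) +
      C.base (C.own (x + d.vec)) = z + C.base (C.own x) by abel, e1] at e2
    exact hx e2.symm
  rw [h4] at h
  obtain ⟨k1, k2, k3, k4, j, j1, j2, j3⟩ := C.contact (C.mem_sub_base x) hy hd h3 h
  have k1' := sub_eq_iff_eq_add'.1 (C.base_injective k1)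
  refine ⟨?_, k1', s, t, hs, k1' ▸ ht, k2, j, j1, j2, sub_eq_iff_eq_add.1 j3⟩
  rw [h4, k3]; rfl

theorem bond_enlarge_pad {α : Assembly} {p : ℤ × ℤ} {d : Dir} {s t : Tile} (hs : α p = some s)
    (ht : α (p + d.vec) = some t) (he : s d = t d.opp) (hg : s d ∈ C.glueSet) {j : ℕ}
    (hj : j < C.temp) (hj' : j < (s d).strength) :
    bond (C.enlarge α) (C.padCell d.flip (C.pos (s d) j) + C.base p) d.flip = 1 ∧
      C.own (C.padCell d.flip (C.pos (s d) j) + C.base p) = p ∧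
      C.own (C.padCell d.flip (C.pos (s d) j) + C.base p + d.flip.vec) = p + d.vec := by
  have hr := C.pos_range _ hg _ hj
  have m1 := C.mem_padCell hr d.flip
  have m2 := C.mem_padCell hr d.flip.opp
  have ez : C.padCell d.flip (C.pos (s d) j) + C.base p + d.flip.vec =
      C.padCell d.flip.opp (C.pos (s d) j) + C.base (p + d.vec) := by
    rw [add_right_comm, padCell_add_vec, Dir.flip_flip, base_add]; abel
  have e1 := C.enlarge_add_base α m1 p
  have e2 := C.enlarge_add_base α m2 (p + d.vec)
  rw [← ez] at e2
  rw [hs, Option.map_some] at e1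
  rw [ht, Option.map_some] at e2
  have n1 : ¬ C.Mem (C.padCell d.flip (C.pos (s d) j) + d.flip.vec) := by
    rw [padCell_add_vec, mem_iff, C.own_add_base m2, Dir.flip_flip]
    exact d.vec_ne_zero
  have n2 : ¬ C.Mem (C.padCell d.flip.opp (C.pos (s d) j) + d.flip.opp.vec) := by
    have := C.padCell_add_vec d.flip.opp (C.pos (s d) j)
    rw [Dir.opp_opp] at this
    rw [this, mem_iff, C.own_add_base m1]
    exact Dir.vec_ne_zero _
  have c : ∀ d', C.content (s d) (C.padIndex d' (C.padCell d' (C.pos (s d) j))) = padGlue true := by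
    intro d'
    rw [padIndex_padCell, content, if_pos ⟨hg, j, hj, rfl⟩, decide_eq_true]
    exact ⟨j, hj, hj', rfl⟩
  have o : ∀ d' : Dir, ∀ u : Tile, u d'.flip = s d →
      C.outerSide u (C.padCell d' (C.pos (s d) j)) d' = padGlue true := by
    intro d' u hu
    rw [outerSide, if_neg, hu, c]
    -- The corner mark overwrites no pad: pads on west faces have first coordinate at least 2r+10.
    rintro ⟨rfl, h0⟩
    have := C.one_le
    unfold PadRange at hr
    simp only [padCell, Prod.ext_iff, Prod.fst_zero] at h0
    omega
  have o1 := o d.flip s (by rw [Dir.flip_flip])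
  have o2 := o d.flip.opp t (by rw [Dir.flip_opp, Dir.flip_flip, he])
  refine ⟨?_, C.own_add_base m1, by rw [ez, C.own_add_base m2]⟩
  rw [bond_of_eq_some e1 e2, C.side_of_not_mem n1, o1]
  · rfl
  · rw [C.side_of_not_mem n1, o1, C.side_of_not_mem n2, o2]

/-! ### Stability of enlarged assemblies -/

/-- All glues of the assembly have pads. -/
def Covers (α : Assembly) : Prop := ∀ x t, α x = some t → ∀ d, t d ∈ C.glueSet

/-- A cut of `α` lifts to a cut of the enlargement along macrotile boundaries. It is crossed by pads
only, and an edge of `α` carries no more active pads than the strength of its glue. -/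
theorem stable_of_stable_enlarge {α : Assembly} (h : Stable C.temp (C.enlarge α)) :
    Stable C.temp α := by
  classical
  rintro A ⟨a, ha, haA⟩ ⟨b, hb, hbA⟩
  obtain ⟨F, hF, hs⟩ := h {x | C.own x ∈ A}
    ⟨C.base a, by rwa [mem_dom_enlarge, own_base], by rwa [Set.mem_ofPred_eq, own_base]⟩
    ⟨C.base b, by rwa [mem_dom_enlarge, own_base], by rwa [Set.mem_ofPred_eq, own_base]⟩
  -- `φ` sends an edge between pads to the edge of `α` that it represents; the weight is then
  -- compared fibre by fibre.
  set φ : (ℤ × ℤ) × Dir → (ℤ × ℤ) × Dir := fun e => (C.own e.1, e.2.flip) with hφ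
  set F' := F.filter fun e => bond (C.enlarge α) e.1 e.2 ≠ 0 with hF'
  have hout : ∀ e ∈ F', C.own (e.1 + e.2.vec) ≠ C.own e.1 ∧ 0 < bond (C.enlarge α) e.1 e.2 := by
    intro e he
    rw [hF', Finset.mem_filter] at he
    refine ⟨fun h => ?_, Nat.pos_of_ne_zero he.2⟩
    have := hF e he.1
    simp only [Set.mem_ofPred_eq, h] at this
    exact this.2 this.1
  refine ⟨F'.image φ, ?_, ?_⟩
  · intro q hq
    obtain ⟨e, he, rfl⟩ := Finset.mem_image.1 hq
    have h1 := hF e (Finset.mem_filter.1 he).1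
    obtain ⟨-, h2, -⟩ := C.bond_enlarge_outer (hout e he).1 (hout e he).2
    simp only [Set.mem_ofPred_eq, h2] at h1
    exact h1
  · rw [← Finset.sum_filter_ne_zero, ← hF',
      ← Finset.sum_fiberwise_of_maps_to (fun e he => Finset.mem_image_of_mem φ he)] at hs
    refine hs.trans (Finset.sum_le_sum fun q hq => ?_)
    obtain ⟨e, he, rfl⟩ := Finset.mem_image.1 hq
    obtain ⟨-, h2, s, t, s1, t1, st, -⟩ := C.bond_enlarge_outer (hout e he).1 (hout e he).2
    rw [bond_of_eq_some s1 t1 st]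
    calc ∑ i ∈ F' with φ i = φ e, bond (C.enlarge α) i.1 i.2
        = ∑ i ∈ F' with φ i = φ e, 1 := Finset.sum_congr rfl fun i hi =>
          (C.bond_enlarge_outer (hout i (Finset.mem_filter.1 hi).1).1
            (hout i (Finset.mem_filter.1 hi).1).2).1
      _ = ({i ∈ F' | φ i = φ e}).card := by simp
      _ ≤ ((Finset.range (s e.2.flip).strength).image fun j =>
          (C.padCell e.2 (C.pos (s e.2.flip) j) + C.base (C.own e.1), e.2)).card := by
        refine Finset.card_le_card fun i hi => ?_
        rw [Finset.mem_filter] at hi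
        obtain ⟨hi, hie⟩ := hi
        simp only [hφ, Prod.mk.injEq] at hie
        have hd : i.2 = e.2 := by rw [← Dir.flip_flip i.2, hie.2, Dir.flip_flip]
        obtain ⟨-, -, s', -, s1', -, -, j, -, j2, j3⟩ :=
          C.bond_enlarge_outer (hout i hi).1 (hout i hi).2
        rw [hie.1, s1, Option.some.injEq] at s1'
        subst s1'
        rw [hd] at j2 j3
        rw [hie.1] at j3
        exact Finset.mem_image.2 ⟨j, Finset.mem_range.2 j2, Prod.ext j3.symm hd.symm⟩
      _ ≤ (s e.2.flip).strength := Finset.card_image_le.trans (by simp)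

/-- A cut through a macrotile is heavy because of its inner edges. Any other cut comes from a cut of
`α`, each of whose edges is replaced by as many unit pads as its weight, up to `temp`. -/
theorem stable_enlarge {α : Assembly} (hα : C.Covers α) (h : Stable C.temp α) :
    Stable C.temp (C.enlarge α) := by
  classical
  rintro A ⟨a, ha, haA⟩ ⟨b, hb, hbA⟩
  by_cases hsplit : ∃ p ∈ dom α, ∃ x y, C.Mem x ∧ C.Mem y ∧ x + C.base p ∈ A ∧ y + C.base p ∉ A
  · obtain ⟨p, hp, x, y, hx, hy, hxA, hyA⟩ := hsplit
    obtain ⟨e₁, e₂, hne, c₁, c₂⟩ :=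
      exists_two_crossings C.one_le (A := {x | x + C.base p ∈ A}) hx hxA hy hyA
    refine ⟨{(e₁.1 + C.base p, e₁.2), (e₂.1 + C.base p, e₂.2)}, ?_, ?_⟩
    · intro e he
      simp only [Finset.mem_insert, Finset.mem_singleton] at he
      rcases he with rfl | rfl
      · exact ⟨c₁.2.2.1, by rw [add_right_comm]; exact c₁.2.2.2⟩
      · exact ⟨c₂.2.2.1, by rw [add_right_comm]; exact c₂.2.2.2⟩
    · rw [Finset.sum_pair]
      · dsimp only
        rw [C.bond_enlarge_inner hp c₁.1 c₁.2.1, C.bond_enlarge_inner hp c₂.1 c₂.2.1, ← two_mul]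
        exact C.le_two_mul_innerStrength
      · intro h
        simp only [Prod.mk.injEq, add_left_inj] at h
        exact hne (Prod.ext h.1 h.2)
  · have hA : ∀ x, C.own x ∈ dom α → (x ∈ A ↔ C.base (C.own x) ∈ A) := by
      intro x hx
      constructor
      · intro h
        by_contra h'
        exact hsplit ⟨_, hx, _, 0, C.mem_sub_base x, C.mem_zero, by simpa using h,
          by simpa using h'⟩
      · intro h
        by_contra h'
        exact hsplit ⟨_, hx, 0, _, C.mem_zero, C.mem_sub_base x, by simpa using h,
          by simpa using h'⟩
    rw [mem_dom_enlarge] at ha hb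
    obtain ⟨F, hF, hs⟩ := h {p | C.base p ∈ A} ⟨_, ha, (hA a ha).1 haA⟩ ⟨_, hb, mt (hA b hb).2 hbA⟩
    rw [← Finset.sum_filter_ne_zero] at hs
    set F' := F.filter fun e => bond α e.1 e.2 ≠ 0 with hF'
    have hpos : ∀ e ∈ F', 0 < bond α e.1 e.2 := fun e he =>
      Nat.pos_of_ne_zero (Finset.mem_filter.1 he).2
    -- The default `blankGlue` plays no role: only edges of positive weight are used, and these
    -- start at a tile.
    set g : (ℤ × ℤ) × Dir → Glue := fun e => (α e.1).elim blankGlue fun s => s e.2 with hg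
    set ψ : ((ℤ × ℤ) × Dir) × ℕ → (ℤ × ℤ) × Dir := fun q =>
      (C.padCell q.1.2.flip (C.pos (g q.1) q.2) + C.base q.1.1, q.1.2.flip) with hψ
    have key : ∀ e ∈ F', bond α e.1 e.2 = (g e).strength ∧ g e ∈ C.glueSet ∧
        e.1 ∈ dom α ∧ e.1 + e.2.vec ∈ dom α ∧ ∀ j < C.temp,
          j < (g e).strength → bond (C.enlarge α) (ψ (e, j)).1 (ψ (e, j)).2 = 1 ∧
            C.own (ψ (e, j)).1 = e.1 ∧
            C.own ((ψ (e, j)).1 + (ψ (e, j)).2.vec) = e.1 + e.2.vec := by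
      intro e he
      obtain ⟨s, t, s1, t1, st, hb⟩ := exists_of_bond_pos (hpos e he)
      have ge : g e = s e.2 := by simp [hg, s1]
      have gm := hα _ _ s1 e.2
      simp only [hψ, ge]
      exact ⟨hb, gm, mem_dom.2 ⟨_, s1⟩, mem_dom.2 ⟨_, t1⟩,
        fun j j1 j2 => C.bond_enlarge_pad s1 t1 st gm j1 j2⟩
    set P := (F' ×ˢ Finset.range C.temp).filter fun q => q.2 < (g q.1).strength with hP
    have hPm : ∀ q ∈ P, q.1 ∈ F' ∧ q.2 < C.temp ∧ q.2 < (g q.1).strength := by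
      intro q hq
      simpa [hP, and_assoc] using hq
    refine ⟨P.image ψ, ?_, ?_⟩
    · intro e he
      obtain ⟨q, hq, rfl⟩ := Finset.mem_image.1 he
      obtain ⟨q1, q2, q3⟩ := hPm q hq
      obtain ⟨-, -, k1, k2, k⟩ := key _ q1
      obtain ⟨-, l1, l2⟩ := k _ q2 q3
      have hc := hF _ (Finset.mem_filter.1 q1).1
      refine ⟨(hA _ (by rw [l1]; exact k1)).2 ?_, mt (hA _ (by rw [l2]; exact k2)).1 ?_⟩
      · rw [l1]; exact hc.1
      · rw [l2]; exact hc.2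
    · rw [Finset.sum_image]
      · have e1 : ∀ q ∈ P, bond (C.enlarge α) (ψ q).1 (ψ q).2 = 1 := fun q hq =>
          ((key _ (hPm q hq).1).2.2.2.2 _ (hPm q hq).2.1 (hPm q hq).2.2).1
        rw [Finset.sum_congr rfl e1, hP, Finset.sum_filter, Finset.sum_product]
        have e2 : ∀ e ∈ F', (∑ j ∈ Finset.range C.temp, if j < (g e).strength then 1 else 0) =
            min C.temp (bond α e.1 e.2) := by
          intro e he
          rw [(key e he).1, ← Finset.sum_filter, Finset.sum_const, smul_eq_mul, mul_one,
            ← Finset.card_range (min _ _)]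
          congr 1
          ext j
          simp
        rw [Finset.sum_congr rfl e2]
        -- The pads of an edge weigh the minimum of `temp` and its weight. Either a single edge
        -- already reaches `temp`, or nothing was truncated.
        by_cases hbig : ∃ e ∈ F', C.temp ≤ bond α e.1 e.2
        · obtain ⟨e, he, hbe⟩ := hbig
          refine le_trans ?_ (Finset.single_le_sum (fun _ _ => Nat.zero_le _) he)
          exact le_min le_rfl hbe
        · push Not at hbig
          rwa [Finset.sum_congr rfl fun e he => min_eq_right (hbig e he).le]
      -- An edge between pads determines its macrotile through `own`, its direction, and by
      -- `pos_inj` the number of the pad.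
      · intro q hq q' hq' h
        obtain ⟨q1, q2, q3⟩ := hPm q hq
        obtain ⟨q1', q2', q3'⟩ := hPm q' hq'
        obtain ⟨-, gm, -, -, k⟩ := key _ q1
        obtain ⟨-, gm', -, -, k'⟩ := key _ q1'
        have hd : q.1.2 = q'.1.2 := by
          have := congrArg (fun e => e.2.flip) h
          simpa [hψ] using this
        have ho : q.1.1 = q'.1.1 := by
          rw [← (k _ q2 q3).2.1, ← (k' _ q2' q3').2.1]
          exact congrArg (fun e => C.own e.1) h
        have hq1 : q.1 = q'.1 := Prod.ext ho hd
        have hz := congrArg Prod.fst h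
        simp only [hψ, hq1, add_left_inj] at hz
        rw [hq1] at gm
        rw [padCell_eq_iff, padIndex_padCell] at hz
        exact Prod.ext hq1 (C.pos_inj _ gm _ q2 _ gm _ q2' hz).2

end Code
/-! ### Supertiles and assembly sequences -/

theorem mem_supertile_self (α : Assembly) : α ∈ supertile α := ⟨0, (translate_zero α).symm⟩

theorem supertile_translate (u : ℤ × ℤ) (α : Assembly) :
    supertile (translate u α) = supertile α := by
  ext β
  constructor
  · rintro ⟨v, rfl⟩
    exact ⟨v + u, translate_translate v u α⟩
  · rintro ⟨v, rfl⟩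
    exact ⟨v - u, by rw [translate_translate, sub_add_cancel]⟩

theorem supertile_eq_of_mem {α β : Assembly} (h : α ∈ supertile β) : supertile α = supertile β := by
  obtain ⟨u, rfl⟩ := h
  exact supertile_translate u β

theorem IsOver.translate {T : Finset Tile} {α : Assembly} (h : IsOver T α) (u : ℤ × ℤ) :
    IsOver T (translate u α) := fun x t hx => h (x - u) t hx

theorem IsOver.union {T : Finset Tile} {α β : Assembly} (h : IsOver T α) (h' : IsOver T β) :
    IsOver T (union α β) := by
  intro x t hx
  unfold TwoHAM.union at hx
  rcases hα : α x with _ | s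
  · rw [hα] at hx; exact h' x t hx
  · rw [hα] at hx; exact h x t (hα.trans hx)

theorem le_union_left (α β : Assembly) (x : ℤ × ℤ) (t : Tile) (h : α x = some t) :
    union α β x = some t := by
  simp [union, h]

theorem bond_opp (α : Assembly) (x : ℤ × ℤ) (d : Dir) :
    bond α (x + d.vec) d.opp = bond α x d := by
  have key : ∀ x d, bond α x d ≤ bond α (x + d.vec) d.opp := by
    intro x d
    rcases Nat.eq_zero_or_pos (bond α x d) with h0 | h0
    · omega
    · obtain ⟨s, t, hs, ht, he, hb⟩ := exists_of_bond_pos h0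
      rw [hb, bond_of_eq_some ht (t := s), he]
      · rw [Dir.vec_opp, add_neg_cancel_right, hs]
      · rw [Dir.opp_opp, he]
  refine le_antisymm ?_ (key x d)
  have := key (x + d.vec) d.opp
  rwa [Dir.opp_opp, Dir.vec_opp, add_neg_cancel_right] at this

/-- A cut either splits one of the two stable parts, or separates them from each other and is then
crossed by all of `F`. -/
theorem stable_union {τ : ℕ} {α β : Assembly} (hα : Stable τ α) (hβ : Stable τ β)
    (hd : Disjoint (dom α) (dom β)) {F : Finset ((ℤ × ℤ) × Dir)}
    (hF : ∀ e ∈ F, e.1 ∈ dom α ∧ e.1 + e.2.vec ∈ dom β)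
    (hs : τ ≤ ∑ e ∈ F, bond (union α β) e.1 e.2) : Stable τ (union α β) := by
  classical
  rintro A ⟨a, ha, haA⟩ ⟨b, hb, hbA⟩
  by_cases h1 : (dom α ∩ A).Nonempty ∧ (dom α \ A).Nonempty
  · obtain ⟨F', hF', hs'⟩ := hα A h1.1 h1.2
    exact ⟨F', hF', hs'.trans (Finset.sum_le_sum fun e _ =>
      bond_le_of_le (le_union_left α β) _ _)⟩
  by_cases h2 : (dom β ∩ A).Nonempty ∧ (dom β \ A).Nonempty
  · obtain ⟨F', hF', hs'⟩ := hβ A h2.1 h2.2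
    rw [union_comm hd]
    exact ⟨F', hF', hs'.trans (Finset.sum_le_sum fun e _ =>
      bond_le_of_le (le_union_left β α) _ _)⟩
  rw [dom_union] at ha hb
  have c1 : ∀ x ∈ dom α, ∀ y ∈ dom α, x ∈ A → y ∈ A := fun x hx y hy hxA => by
    by_contra hyA
    exact h1 ⟨⟨x, hx, hxA⟩, ⟨y, hy, hyA⟩⟩
  have c2 : ∀ x ∈ dom β, ∀ y ∈ dom β, x ∈ A → y ∈ A := fun x hx y hy hxA => by
    by_contra hyA
    exact h2 ⟨⟨x, hx, hxA⟩, ⟨y, hy, hyA⟩⟩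
  rcases ha with ha | ha
  · have hb : b ∈ dom β := hb.resolve_left fun h => hbA (c1 a ha b h haA)
    exact ⟨F, fun e he => ⟨c1 a ha _ (hF e he).1 haA, fun h => hbA (c2 _ (hF e he).2 b hb h)⟩, hs⟩
  · have hb : b ∈ dom α := hb.resolve_right fun h => hbA (c2 a ha b h haA)
    -- Here `A` contains the second part, and edges of a cut are listed from their end in `A`; so
    -- they are reversed.
    refine ⟨F.image fun e => (e.1 + e.2.vec, e.2.opp), ?_, ?_⟩
    · intro e he
      obtain ⟨e', he', rfl⟩ := Finset.mem_image.1 he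
      dsimp only
      rw [Dir.vec_opp, add_neg_cancel_right]
      exact ⟨c2 a ha _ (hF e' he').2 haA, fun h => hbA (c1 _ (hF e' he').1 b hb h)⟩
    · rw [Finset.sum_image]
      · simpa only [bond_opp] using hs
      · rintro ⟨x, d⟩ _ ⟨x', d'⟩ _ h
        simp only [Prod.mk.injEq] at h
        have hdd : d = d' := by rw [← Dir.opp_opp d, h.2, Dir.opp_opp]
        subst hdd
        exact Prod.ext (add_right_cancel h.1) rfl

/-- The two parts of a stable union are joined by edges of total weight at least `τ`. -/
theorem exists_edges_of_stable_union {τ : ℕ} {α β : Assembly} (h : Stable τ (union α β))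
    (hd : Disjoint (dom α) (dom β)) (hα : (dom α).Nonempty) (hβ : (dom β).Nonempty) :
    ∃ F : Finset ((ℤ × ℤ) × Dir), (∀ e ∈ F, e.1 ∈ dom α ∧ e.1 + e.2.vec ∈ dom β) ∧
      τ ≤ ∑ e ∈ F, bond (union α β) e.1 e.2 := by
  classical
  obtain ⟨a, ha⟩ := hα
  obtain ⟨b, hb⟩ := hβ
  obtain ⟨F, hF, hs⟩ := h (dom α) ⟨a, by rw [dom_union]; exact .inl ha, ha⟩
    ⟨b, by rw [dom_union]; exact .inr hb, Set.disjoint_right.1 hd hb⟩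
  rw [← Finset.sum_filter_ne_zero] at hs
  refine ⟨_, fun e he => ?_, hs⟩
  rw [Finset.mem_filter] at he
  refine ⟨(hF e he.1).1, ?_⟩
  obtain ⟨_, t, -, ht, -⟩ := exists_of_bond_pos (Nat.pos_of_ne_zero he.2)
  have := mem_dom.2 ⟨t, ht⟩
  rw [dom_union] at this
  exact this.resolve_left (hF e he.1).2

/-- A sequence of attachments of supertiles that satisfy `P`, possibly with pauses. -/
def Chain (τ : ℕ) (P : Set Assembly → Prop) (f : ℕ → Assembly) : Prop :=
  ∀ i, f (i + 1) = f i ∨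
    ∃ β : Assembly, P (supertile β) ∧ Disjoint (dom (f i)) (dom β) ∧
      Stable τ (union (f i) β) ∧ f (i + 1) = union (f i) β

/-- `γ` is the union of the assemblies `f i`. -/
def IsLimit (f : ℕ → Assembly) (γ : Assembly) : Prop := ∀ x t, γ x = some t ↔ ∃ i, f i x = some t

theorem Chain.mono {τ : ℕ} {P : Set Assembly → Prop} {f : ℕ → Assembly} (h : Chain τ P f)
    {i j : ℕ} (hij : i ≤ j) {x : ℤ × ℤ} {t : Tile} (hx : f i x = some t) : f j x = some t := by
  induction hij with
  | refl => exact hx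
  | step _ ih =>
    rcases h _ with h | ⟨β, -, -, -, h⟩
    · rw [h]; exact ih
    · rw [h]; exact le_union_left _ _ _ _ ih

theorem Chain.exists_isLimit {τ : ℕ} {P : Set Assembly → Prop} {f : ℕ → Assembly}
    (h : Chain τ P f) : ∃ γ, IsLimit f γ := by
  classical
  refine ⟨fun x => if hx : ∃ t i, f i x = some t then some hx.choose else none, fun x t => ?_⟩
  dsimp only
  split_ifs with hx
  · obtain ⟨j, hj⟩ := hx.choose_spec
    constructor
    · intro e
      rw [Option.some.injEq] at e
      exact ⟨j, e ▸ hj⟩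
    · rintro ⟨i, hi⟩
      exact (h.mono (le_max_right i j) hj).symm.trans (h.mono (le_max_left i j) hi)
  · constructor
    · intro e; cases e
    · rintro ⟨i, hi⟩
      exact absurd ⟨t, i, hi⟩ hx

theorem IsLimit.unique {f : ℕ → Assembly} {γ γ' : Assembly} (h : IsLimit f γ) (h' : IsLimit f γ') :
    γ = γ' := by
  funext x
  ext t
  rw [h, h']

theorem Chain.translate {τ : ℕ} {P : Set Assembly → Prop} {f : ℕ → Assembly} (h : Chain τ P f)
    (u : ℤ × ℤ) : Chain τ P fun i => translate u (f i) := by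
  intro i
  rcases h i with h | ⟨β, h1, h2, h3, h4⟩
  · left; dsimp only; rw [h]
  · refine .inr ⟨TwoHAM.translate u β, ?_, ?_, ?_, ?_⟩
    · rwa [supertile_translate]
    · rwa [disjoint_translate_iff]
    · rw [← translate_union]; exact h3.translate u
    · dsimp only; rw [h4, translate_union]

theorem IsLimit.translate {f : ℕ → Assembly} {γ : Assembly} (h : IsLimit f γ) (u : ℤ × ℤ) :
    IsLimit (fun i => translate u (f i)) (translate u γ) := fun _ _ => h _ _

theorem Reachable.spec {S : TAS} {s : Set Assembly} (h : Reachable S s) :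
    ∃ α, s = supertile α ∧ (dom α).Nonempty ∧ IsOver S.tiles α ∧ Stable S.temp α := by
  induction h with
  | init s hs =>
    obtain ⟨α, h1, h2, h3, h4⟩ := S.init_spec s hs
    exact ⟨α, h4, h1, h2, h3⟩
  | attach a b c _ _ hc iha ihb =>
    obtain ⟨α, hα, β, hβ, h1, h2, rfl⟩ := hc
    obtain ⟨α', rfl, k1, k2, -⟩ := iha
    obtain ⟨β', rfl, l1, l2, -⟩ := ihb
    obtain ⟨u, rfl⟩ := hα
    obtain ⟨v, rfl⟩ := hβ
    refine ⟨_, rfl, ?_, (k2.translate u).union (l2.translate v), h2⟩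
    obtain ⟨x, hx⟩ := k1
    rw [dom_union]
    exact ⟨x + u, .inl (by rw [mem_dom_translate]; simpa using hx)⟩

theorem Reachable.of_supertile {S : TAS} {α : Assembly} (h : Reachable S (supertile α)) :
    (dom α).Nonempty ∧ IsOver S.tiles α ∧ Stable S.temp α := by
  obtain ⟨β, e, ⟨x, hx⟩, h2, h3⟩ := h.spec
  obtain ⟨u, rfl⟩ : α ∈ supertile β := e ▸ mem_supertile_self α
  exact ⟨⟨x + u, by rw [mem_dom_translate]; simpa using hx⟩, h2.translate u, h3.translate u⟩

theorem Chain.reachable {S : TAS} {f : ℕ → Assembly} (h : Chain S.temp (Reachable S) f)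
    (h0 : Reachable S (supertile (f 0))) (i : ℕ) : Reachable S (supertile (f i)) := by
  induction i with
  | zero => exact h0
  | succ i ih =>
    rcases h i with h | ⟨β, h1, h2, h3, h4⟩
    · rwa [h]
    · exact .attach _ _ _ ih h1 ⟨_, mem_supertile_self _, _, mem_supertile_self _, h2, h3,
        by rw [h4]⟩

/-- Translating a whole assembly sequence makes the chosen representative itself its limit. -/
theorem mem_producible_iff {S : TAS} {α : Assembly} : supertile α ∈ producible S ↔
    ∃ f, supertile (f 0) ∈ S.init ∧ Chain S.temp (Reachable S) f ∧ IsLimit f α := by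
  constructor
  · rintro ⟨a, ha, f, hf, hc, γ, hγ, e⟩
    obtain ⟨β, -, -, -, rfl⟩ := S.init_spec a ha
    obtain ⟨u, rfl⟩ : α ∈ supertile γ := e ▸ mem_supertile_self α
    refine ⟨fun i => translate u (f i), ?_, Chain.translate hc u, IsLimit.translate hγ u⟩
    rwa [supertile_translate, supertile_eq_of_mem hf]
  · rintro ⟨f, h1, h2, h3⟩
    exact ⟨_, h1, f, mem_supertile_self _, h2, α, h3, rfl⟩

theorem exists_of_mem_producible {S : TAS} {a : Set Assembly} (h : a ∈ producible S) :
    ∃ α, a = supertile α := by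
  obtain ⟨_, _, _, _, _, γ, _, e⟩ := h
  exact ⟨γ, e⟩

theorem dom_nonempty_of_producible {S : TAS} {α : Assembly} (h : supertile α ∈ producible S) :
    (dom α).Nonempty := by
  obtain ⟨f, h1, -, h3⟩ := mem_producible_iff.1 h
  obtain ⟨x, hx⟩ := (Reachable.of_supertile (.init _ h1)).1
  obtain ⟨t, ht⟩ := mem_dom.1 hx
  exact ⟨x, mem_dom.2 ⟨t, (h3 x t).2 ⟨0, ht⟩⟩⟩

theorem isOver_of_producible {S : TAS} {α : Assembly} (h : supertile α ∈ producible S) :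
    IsOver S.tiles α := by
  obtain ⟨f, h1, h2, h3⟩ := mem_producible_iff.1 h
  intro x t ht
  obtain ⟨i, hi⟩ := (h3 x t).1 ht
  exact (h2.reachable (.init _ h1) i).of_supertile.2.1 x t hi

theorem IsLimit.dom_subset {f : ℕ → Assembly} {γ : Assembly} (h : IsLimit f γ) (i : ℕ) :
    dom (f i) ⊆ dom γ := by
  intro x hx
  obtain ⟨t, ht⟩ := mem_dom.1 hx
  exact mem_dom.2 ⟨t, (h x t).2 ⟨i, ht⟩⟩

theorem IsLimit.exists_forall_mem {τ : ℕ} {P : Set Assembly → Prop} {f : ℕ → Assembly}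
    {γ : Assembly} (h : IsLimit f γ) (hc : Chain τ P f) (X : Finset (ℤ × ℤ))
    (hX : ∀ x ∈ X, x ∈ dom γ) : ∃ n, ∀ i, n ≤ i → ∀ x ∈ X, x ∈ dom (f i) := by
  classical
  induction X using Finset.induction_on with
  | empty => exact ⟨0, by simp⟩
  | insert a X _ ih =>
    obtain ⟨n, hn⟩ := ih fun x hx => hX x (Finset.mem_insert_of_mem hx)
    obtain ⟨t, ht⟩ := mem_dom.1 (hX a (Finset.mem_insert_self a X))
    obtain ⟨j, hj⟩ := (h a t).1 ht
    refine ⟨max n j, fun i hi x hx => ?_⟩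
    rcases Finset.mem_insert.1 hx with rfl | hx
    · exact mem_dom.2 ⟨t, hc.mono ((le_max_right _ _).trans hi) hj⟩
    · exact hn i ((le_max_left _ _).trans hi) x hx

/-- The producible supertiles are closed under combination. -/
theorem combine_subset_producible {S : TAS} {a b c : Set Assembly} (ha : a ∈ producible S)
    (hb : b ∈ producible S) (hc : c ∈ combine S.temp a b) : c ∈ producible S := by
  classical
  obtain ⟨α, hα, β, hβ, hd, hst, rfl⟩ := hc
  obtain ⟨α', rfl⟩ := exists_of_mem_producible ha
  obtain ⟨β', rfl⟩ := exists_of_mem_producible hb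
  rw [← supertile_eq_of_mem hα] at ha
  rw [← supertile_eq_of_mem hβ] at hb
  -- Even between infinite assemblies, finitely many edges reach the weight needed. From some stage
  -- `n` on, both sequences contain all their ends, so any two later stages already combine.
  obtain ⟨F, hF, hs⟩ := exists_edges_of_stable_union hst hd (dom_nonempty_of_producible ha)
    (dom_nonempty_of_producible hb)
  obtain ⟨f, f0, fc, fl⟩ := mem_producible_iff.1 ha
  obtain ⟨g, g0, gc, gl⟩ := mem_producible_iff.1 hb
  have fr := fc.reachable (.init _ f0)
  have gr := gc.reachable (.init _ g0)
  obtain ⟨n₁, hn₁⟩ := fl.exists_forall_mem fc (F.image fun e => e.1) (by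
    intro x hx
    obtain ⟨e, he, rfl⟩ := Finset.mem_image.1 hx
    exact (hF e he).1)
  obtain ⟨n₂, hn₂⟩ := gl.exists_forall_mem gc (F.image fun e => e.1 + e.2.vec) (by
    intro x hx
    obtain ⟨e, he, rfl⟩ := Finset.mem_image.1 hx
    exact (hF e he).2)
  obtain ⟨n, hn1, hn2⟩ : ∃ n, n₁ ≤ n ∧ n₂ ≤ n := ⟨max n₁ n₂, le_max_left _ _, le_max_right _ _⟩
  have hdij : ∀ i j, Disjoint (dom (f i)) (dom (g j)) := fun i j =>
    hd.mono (fl.dom_subset i) (gl.dom_subset j)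
  have hstij : ∀ i j, n ≤ i → n ≤ j → Stable S.temp (union (f i) (g j)) := by
    intro i j hi hj
    have hF' : ∀ e ∈ F, e.1 ∈ dom (f i) ∧ e.1 + e.2.vec ∈ dom (g j) := fun e he =>
      ⟨hn₁ i (hn1.trans hi) _ (Finset.mem_image_of_mem _ he),
        hn₂ j (hn2.trans hj) _ (Finset.mem_image_of_mem (fun e => e.1 + e.2.vec) he)⟩
    refine stable_union (fr i).of_supertile.2.2 (gr j).of_supertile.2.2 (hdij i j) hF'
      (hs.trans (Finset.sum_le_sum fun e he => ?_))
    obtain ⟨s, hs⟩ := mem_dom.1 (hF' e he).1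
    obtain ⟨t, ht⟩ := mem_dom.1 (hF' e he).2
    have hs' : union α β e.1 = some s := (union_eq_some hd).2 (.inl ((fl _ _).2 ⟨i, hs⟩))
    have ht' : union α β (e.1 + e.2.vec) = some t :=
      (union_eq_some hd).2 (.inr ((gl _ _).2 ⟨j, ht⟩))
    have hs'' : union (f i) (g j) e.1 = some s := (union_eq_some (hdij i j)).2 (.inl hs)
    have ht'' : union (f i) (g j) (e.1 + e.2.vec) = some t :=
      (union_eq_some (hdij i j)).2 (.inr ht)
    unfold bond
    rw [hs', ht', hs'', ht'']
  have stepL : ∀ i j, n ≤ i → n ≤ j → union (f (i + 1)) (g j) = union (f i) (g j) ∨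
      ∃ δ : Assembly, Reachable S (supertile δ) ∧ Disjoint (dom (union (f i) (g j))) (dom δ) ∧
        Stable S.temp (union (union (f i) (g j)) δ) ∧
        union (f (i + 1)) (g j) = union (union (f i) (g j)) δ := by
    intro i j hi hj
    rcases fc i with h | ⟨δ, h1, h2, -, h4⟩
    · left; rw [h]
    · have hδ : Disjoint (dom δ) (dom (g j)) := by
        refine (hdij (i + 1) j).mono_left ?_
        rw [h4, dom_union]; exact Set.subset_union_right
      have e : union (f (i + 1)) (g j) = union (union (f i) (g j)) δ := by
        rw [h4]
        funext x
        have := congrFun (union_comm hδ) x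
        simp only [union] at *
        cases f i x
        · simpa using this
        · rfl
      refine .inr ⟨δ, h1, ?_, e ▸ hstij _ _ (by omega) hj, e⟩
      rw [dom_union, Set.disjoint_union_left]
      exact ⟨h2, hδ.symm⟩
  have stepR : ∀ i j, n ≤ i → n ≤ j → union (f i) (g (j + 1)) = union (f i) (g j) ∨
      ∃ δ : Assembly, Reachable S (supertile δ) ∧ Disjoint (dom (union (f i) (g j))) (dom δ) ∧
        Stable S.temp (union (union (f i) (g j)) δ) ∧
        union (f i) (g (j + 1)) = union (union (f i) (g j)) δ := by
    intro i j hi hj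
    rcases gc j with h | ⟨δ, h1, h2, -, h4⟩
    · left; rw [h]
    · have hδ : Disjoint (dom (f i)) (dom δ) := by
        refine (hdij i (j + 1)).mono_right ?_
        rw [h4, dom_union]; exact Set.subset_union_right
      have e : union (f i) (g (j + 1)) = union (union (f i) (g j)) δ := by
        rw [h4]
        funext x
        simp only [union]
        cases f i x <;> rfl
      refine .inr ⟨δ, h1, ?_, e ▸ hstij _ _ hi (by omega), e⟩
      rw [dom_union, Set.disjoint_union_left]
      exact ⟨hδ, h2⟩
  -- Sequence for the union: build `f n`, attach the finite stage `g n` at once, then advance `f`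
  -- and `g` alternately. Only reachable supertiles are attached, although the second summand itself
  -- may need infinitely many steps.
  refine mem_producible_iff.2 ⟨fun i => if i ≤ n then f i else
    union (f (n + (i - n) / 2)) (g (n + (i - n - 1) / 2)), by simpa using f0, ?_, ?_⟩
  · intro i
    rcases lt_trichotomy i n with h | rfl | h
    · simp only [if_pos h.le, if_pos (show i + 1 ≤ n by omega)]
      exact fc i
    · right
      refine ⟨g i, gr i, ?_, ?_, ?_⟩
      · simpa using hdij i i
      · simpa using hstij i i le_rfl le_rfl
      · simp
    · simp only [if_neg (show ¬ i ≤ n by omega), if_neg (show ¬ i + 1 ≤ n by omega)]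
      obtain ⟨k, hk | hk⟩ : ∃ k, i = n + 1 + 2 * k ∨ i = n + 2 + 2 * k := by
        refine ⟨(i - n - 1) / 2, ?_⟩
        omega
      · rw [show n + (i + 1 - n) / 2 = n + k + 1 by omega,
          show n + (i + 1 - n - 1) / 2 = n + k by omega, show n + (i - n) / 2 = n + k by omega,
          show n + (i - n - 1) / 2 = n + k by omega]
        exact stepL _ _ (by omega) (by omega)
      · rw [show n + (i + 1 - n) / 2 = n + k + 1 by omega,
          show n + (i + 1 - n - 1) / 2 = n + k + 1 by omega,
          show n + (i - n) / 2 = n + k + 1 by omega,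
          show n + (i - n - 1) / 2 = n + k by omega]
        exact stepR _ _ (by omega) (by omega)
  · intro x t
    rw [union_eq_some hd, fl, gl]
    constructor
    · rintro (⟨i, hi⟩ | ⟨i, hi⟩)
      · refine ⟨n + 1 + 2 * i, ?_⟩
        dsimp only
        rw [if_neg (by omega), union_eq_some (hdij _ _)]
        exact .inl (fc.mono (by omega) hi)
      · refine ⟨n + 1 + 2 * i, ?_⟩
        dsimp only
        rw [if_neg (by omega), union_eq_some (hdij _ _)]
        exact .inr (gc.mono (by omega) hi)
    · rintro ⟨i, hi⟩
      dsimp only at hi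
      split_ifs at hi with h
      · exact .inl ⟨i, hi⟩
      · rcases (union_eq_some (hdij _ _)).1 hi with hi | hi
        · exact .inl ⟨_, hi⟩
        · exact .inr ⟨_, hi⟩

/-! ### Inertness of single tiles -/

theorem single_eq_some {t s : Tile} {x : ℤ × ℤ} : single t x = some s ↔ x = 0 ∧ t = s := by
  unfold single
  split_ifs with h
  · simp [show x = 0 from h]
  · simp [show ¬ x = 0 from h]

theorem mem_dom_single {t : Tile} {x : ℤ × ℤ} : x ∈ dom (single t) ↔ x = 0 := by
  simp [mem_dom, single_eq_some]

theorem stable_single (τ : ℕ) (t : Tile) : Stable τ (single t) := by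
  rintro A ⟨a, ha, haA⟩ ⟨b, hb, hbA⟩
  rw [mem_dom_single] at ha hb
  exact absurd (hb ▸ ha ▸ haA) hbA

/-- A tile that binds to at most one neighbour, with strength less than `τ`, is not attached. -/
theorem not_stable_of_bonds {τ : ℕ} {α : Assembly} {y z : ℤ × ℤ} (hy : y ∈ dom α) (hz : z ∈ dom α)
    (hne : z ≠ y) (hlt : ∀ d, bond α y d < τ)
    (huniq : ∀ d d', 0 < bond α y d → 0 < bond α y d' → d = d') : ¬ Stable τ α := by
  classical
  intro h
  obtain ⟨F, hF, hs⟩ := h {y} ⟨y, hy, rfl⟩ ⟨z, hz, hne⟩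
  have hF1 : ∀ e ∈ F, e.1 = y := fun e he => (hF e he).1
  by_cases hpos : ∃ d, 0 < bond α y d
  · obtain ⟨d, hd⟩ := hpos
    have h1 : ∑ e ∈ F, bond α e.1 e.2 ≤ ∑ e ∈ {(y, d)}, bond α e.1 e.2 := by
      refine Finset.sum_le_sum_of_ne_zero fun e he h0 => ?_
      rw [Finset.mem_singleton]
      rw [hF1 e he] at h0
      exact Prod.ext (hF1 e he) (huniq _ _ (Nat.pos_of_ne_zero h0) hd)
    rw [Finset.sum_singleton] at h1
    exact absurd (hs.trans h1) (not_le.2 (hlt d))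
  · have h0 : ∑ e ∈ F, bond α e.1 e.2 = 0 := Finset.sum_eq_zero fun e he => by
      rw [hF1 e he]
      exact Nat.eq_zero_of_not_pos fun h => hpos ⟨_, h⟩
    have := hlt .north
    omega

namespace Code

variable (C : Code)

theorem one_le_innerStrength : 1 ≤ C.innerStrength := by
  have := C.two_le; unfold innerStrength; omega

theorem strength_lt_of_mem_palette {g : Glue} (h : g ∈ palette C.innerStrength) :
    g.strength < C.temp := by
  have h1 := C.innerStrength_lt
  have h2 := C.one_le_innerStrength
  simp only [palette, List.mem_cons, List.not_mem_nil, or_false] at h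
  rcases h with rfl | rfl | rfl | rfl | rfl | rfl <;>
    simp only [blankGlue, padGlue, cornerGlue, innerGlue, if_true] <;> first | omega | (simp; omega)

/-- No tile of the universal tile set attaches to another tile. -/
theorem not_stable_single_single {t s : Tile} (ht : t ∈ universalTiles C.innerStrength)
    {u v : ℤ × ℤ}
    (hd : Disjoint (dom (translate u (single t))) (dom (translate v (single s)))) :
    ¬ Stable C.temp (union (translate u (single t)) (translate v (single s))) := by
  have hu : union (translate u (single t)) (translate v (single s)) u = some t :=
    (union_eq_some hd).2 (.inl (by simp [translate, single_eq_some]))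
  have hv : union (translate u (single t)) (translate v (single s)) v = some s :=
    (union_eq_some hd).2 (.inr (by simp [translate, single_eq_some]))
  have hne : v ≠ u := by
    rintro rfl
    have h : ∀ r, v ∈ dom (translate v (single r)) := fun r => by
      simp [mem_dom_translate, mem_dom_single]
    exact Set.disjoint_left.1 hd (h t) (h s)
  have hb : ∀ d, 0 < bond (union (translate u (single t)) (translate v (single s))) u d →
      u + d.vec = v ∧
        bond (union (translate u (single t)) (translate v (single s))) u d = (t d).strength := by
    intro d h
    obtain ⟨_, s', e1, e2, e3, e4⟩ := exists_of_bond_pos h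
    rw [hu, Option.some.injEq] at e1
    subst e1
    refine ⟨?_, e4⟩
    rw [union_eq_some hd, translate_apply, translate_apply, single_eq_some, single_eq_some] at e2
    rcases e2 with ⟨e2, -⟩ | ⟨e2, -⟩
    · rw [add_sub_cancel_left] at e2
      exact absurd e2 d.vec_ne_zero
    · exact sub_eq_zero.1 e2
  refine not_stable_of_bonds (mem_dom.2 ⟨_, hu⟩) (mem_dom.2 ⟨_, hv⟩) hne (fun d => ?_) ?_
  · rcases Nat.eq_zero_or_pos
      (bond (union (translate u (single t)) (translate v (single s))) u d) with h | h
    · have := C.two_le; omega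
    · rw [(hb d h).2]
      exact C.strength_lt_of_mem_palette ((mem_universalTiles.1 ht).1 d)
  · intro d d' h h'
    exact Dir.vec_injective (add_left_cancel ((hb d h).1.trans (hb d' h').1.symm))

/-- No tile of the universal tile set attaches to an enlarged assembly. -/
theorem not_stable_single_enlarge {t : Tile} (ht : t ∈ universalTiles C.innerStrength)
    {α : Assembly} (hα : (dom α).Nonempty) {u v : ℤ × ℤ}
    (hd : Disjoint (dom (translate u (single t))) (dom (translate v (C.enlarge α)))) :
    ¬ Stable C.temp (union (translate u (single t)) (translate v (C.enlarge α))) := by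
  have hu : union (translate u (single t)) (translate v (C.enlarge α)) u = some t :=
    (union_eq_some hd).2 (.inl (by simp [translate, single_eq_some]))
  have hus : u ∈ dom (translate u (single t)) := by simp [mem_dom_translate, mem_dom_single]
  obtain ⟨z, hz⟩ := C.nonempty_dom_enlarge hα
  have hz' : z + v ∈ dom (translate v (C.enlarge α)) := by
    rw [mem_dom_translate]; simpa using hz
  have hb : ∀ d, 0 < bond (union (translate u (single t)) (translate v (C.enlarge α))) u d →
      t d = padGlue true ∧
        bond (union (translate u (single t)) (translate v (C.enlarge α))) u d = (t d).strength := by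
    intro d h
    obtain ⟨_, s', e1, e2, e3, e4⟩ := exists_of_bond_pos h
    rw [hu, Option.some.injEq] at e1
    subst e1
    refine ⟨?_, e4⟩
    rw [e4, e3] at h
    rw [union_eq_some hd, translate_apply, translate_apply, single_eq_some] at e2
    rcases e2 with ⟨e2, -⟩ | e2
    · rw [add_sub_cancel_left] at e2
      exact absurd e2 d.vec_ne_zero
    · obtain ⟨s, e5, rfl⟩ := C.enlarge_eq_some.1 e2
      -- The face turned to the new tile is exposed; otherwise the cell `u` would belong to the same
      -- macrotile and be occupied.
      have hm : ¬ C.Mem (u + d.vec - v - C.base (C.own (u + d.vec - v)) + d.opp.vec) := by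
        intro hm
        rw [Dir.vec_opp, show u + d.vec - v - C.base (C.own (u + d.vec - v)) + -d.vec =
          u - v - C.base (C.own (u + d.vec - v)) by abel, ← own_eq_iff] at hm
        refine Set.disjoint_left.1 hd hus ?_
        rw [mem_dom_translate, mem_dom_enlarge, hm]
        exact mem_dom.2 ⟨_, e5⟩
      rw [e3]
      rw [C.side_of_not_mem hm] at h ⊢
      exact (C.outerSide_of_pos h).1
  refine not_stable_of_bonds (mem_dom.2 ⟨_, hu⟩) (z := z + v) ?_ ?_ (fun d => ?_) ?_
  · rw [dom_union]; exact .inr hz'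
  · intro h
    exact Set.disjoint_left.1 hd hus (h ▸ hz')
  · rcases Nat.eq_zero_or_pos
      (bond (union (translate u (single t)) (translate v (C.enlarge α))) u d) with h | h
    · have := C.two_le; omega
    · rw [(hb d h).2]
      exact C.strength_lt_of_mem_palette ((mem_universalTiles.1 ht).1 d)
  -- Every bond of the new tile uses an active pad, and tiles with two active pads were excluded
  -- from the tile set.
  · intro d d' h h'
    exact (mem_universalTiles.1 ht).2 d d' (hb d h).1 (hb d' h').1

/-- Two enlarged assemblies attach only if they are aligned. -/
theorem aligned_of_stable {α β : Assembly} (hα : (dom α).Nonempty) (hβ : (dom β).Nonempty)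
    {u v : ℤ × ℤ}
    (hd : Disjoint (dom (translate u (C.enlarge α))) (dom (translate v (C.enlarge β))))
    (hs : Stable C.temp (union (translate u (C.enlarge α)) (translate v (C.enlarge β)))) :
    ∃ w, v = u + C.base w := by
  have ne : ∀ (γ : Assembly) (w : ℤ × ℤ), (dom γ).Nonempty →
      (dom (translate w (C.enlarge γ))).Nonempty := by
    intro γ w h
    obtain ⟨z, hz⟩ := C.nonempty_dom_enlarge h
    exact ⟨z + w, by rw [mem_dom_translate]; simpa using hz⟩
  obtain ⟨F, hF, hsum⟩ := exists_edges_of_stable_union hs hd (ne _ _ hα) (ne _ _ hβ)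
  have hpos : 0 < ∑ e ∈ F, bond (union (translate u (C.enlarge α)) (translate v (C.enlarge β)))
      e.1 e.2 := by
    have := C.two_le; omega
  -- A single positive bond between the two parts suffices: `contact` turns it into alignment.
  obtain ⟨⟨x, d⟩, he, hb⟩ := Finset.sum_pos_iff.1 hpos
  obtain ⟨hx, hy⟩ := hF _ he
  dsimp only at hb hx hy
  obtain ⟨s', hs'⟩ := mem_dom.1 hx
  obtain ⟨t', ht'⟩ := mem_dom.1 hy
  obtain ⟨s'', t'', e1, e2, e3, e4⟩ := exists_of_bond_pos hb
  rw [(union_eq_some hd).2 (.inl hs'), Option.some.injEq] at e1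
  rw [(union_eq_some hd).2 (.inr ht'), Option.some.injEq] at e2
  subst e1 e2
  obtain ⟨s, k1, rfl⟩ := C.enlarge_eq_some.1 hs'
  obtain ⟨t, k2, rfl⟩ := C.enlarge_eq_some.1 ht'
  set p := C.own (x - u) with hp
  set q := C.own (x + d.vec - v) with hq
  have hxm := C.mem_sub_base (x - u)
  have hym := C.mem_sub_base (x + d.vec - v)
  have ey : x + d.vec - v - C.base q =
      x - u - C.base p + d.vec - (v + C.base q - (u + C.base p)) := by abel
  rw [← hq, ey] at hym
  rw [ey] at e3
  rw [e4] at hb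
  have hdis : ∀ z, C.Mem z → ¬ C.Mem (z - (v + C.base q - (u + C.base p))) := by
    intro z hz hz'
    have h1 : z + C.base p + u ∈ dom (translate u (C.enlarge α)) := by
      rw [mem_dom_translate, add_sub_cancel_right, mem_dom_enlarge, C.own_add_base hz]
      exact mem_dom.2 ⟨_, k1⟩
    refine Set.disjoint_left.1 hd h1 ?_
    · rw [mem_dom_translate, mem_dom_enlarge, show z + C.base p + u - v =
        z - (v + C.base q - (u + C.base p)) + C.base q by abel, C.own_add_base hz']
      exact mem_dom.2 ⟨_, k2⟩
  have hw := (C.contact hxm hym hdis e3 hb).1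
  refine ⟨p + d.flip.vec - q, ?_⟩
  rw [base_sub, base_add, ← hw]
  abel

/-! ### The representation of enlarged assemblies -/

theorem side_eq_cornerGlue {t : Tile} {x : ℤ × ℤ} (h : C.side t x .west = cornerGlue) : x = 0 := by
  by_contra hx
  unfold side outerSide content at h
  rw [if_neg (show ¬ (Dir.west = Dir.west ∧ x = 0) from fun h => hx h.2)] at h
  split_ifs at h <;>
    simp [innerSide, innerGlue, padGlue, cornerGlue, blankGlue, label_inj] at h

theorem side_zero_west (t : Tile) : C.side t 0 .west = cornerGlue := by
  rw [C.side_of_not_mem, outerSide, if_pos ⟨rfl, rfl⟩]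
  rw [zero_add]
  exact shape_origin_west C.one_le

theorem recordOffset_injective {y y' : ℤ × ℤ} (h : PadRange C.r y.1 y.2)
    (h' : PadRange C.r y'.1 y'.2) {d d' : Dir}
    (e : y + C.recordOffset d = y' + C.recordOffset d') : d = d' ∧ y = y' := by
  unfold PadRange at h h'
  have : d = d' := by
    cases d <;> cases d' <;>
      simp only [recordOffset, Prod.ext_iff, Prod.fst_add, Prod.snd_add] at e <;>
      first | rfl | omega
  subst this
  exact ⟨rfl, add_right_cancel e⟩

/-- The position of the first pad of each glue is recorded in the interior, in a separate region for
each side. Pads alone would not do: those of the east and north sides lie on teeth, outside the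
block. -/
theorem eq_of_side_eq {t t' : Tile} (ht : ∀ d, t d ∈ C.glueSet) (ht' : ∀ d, t' d ∈ C.glueSet)
    (h : ∀ x : ℤ × ℤ, 0 ≤ x.1 → x.1 < 8 * C.r + 12 → 0 ≤ x.2 → x.2 < 8 * C.r + 12 → C.Mem x →
      C.side t x = C.side t' x) : t = t' := by
  classical
  have h2 := C.two_le
  funext d
  have hr := C.pos_range _ (ht d) 0 (by omega)
  obtain ⟨y, hy⟩ : ∃ y, y = C.pos (t d) 0 + C.recordOffset d := ⟨_, rfl⟩
  have hb : 2 * C.r + 2 ≤ y.1 ∧ y.1 < 8 * C.r + 11 ∧ 2 * C.r + 2 ≤ y.2 ∧ y.2 < 8 * C.r + 11 := by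
    have := C.one_le
    unfold PadRange at hr
    rw [hy]
    cases d <;> simp only [recordOffset, Prod.fst_add, Prod.snd_add] <;> omega
  have h1 := C.one_le
  have m1 : C.Mem y := shape_center h1 (by omega) (by omega) (by omega) (by omega)
  have m2 : C.Mem (y + Dir.north.vec) := by
    apply shape_center h1 <;> simp only [Dir.vec, Prod.fst_add, Prod.snd_add] <;> omega
  have e := congrFun (h y (by omega) (by omega) (by omega) (by omega) m1) .north
  rw [C.side_of_mem m2, C.side_of_mem m2] at e
  have hrec : C.Recorded t' y := of_decide_eq_true
    ((innerGlue_injective e).symm.trans (decide_eq_true ⟨d, hy⟩))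
  obtain ⟨d', hd'⟩ := hrec
  obtain ⟨rfl, hp⟩ := C.recordOffset_injective hr (C.pos_range _ (ht' d') 0 (by omega))
    (hy.symm.trans hd')
  exact (C.pos_inj _ (ht _) _ (by omega) _ (ht' _) _ (by omega) hp).1

/-- The scale factor. -/
def size : ℕ := (8 * C.r + 12).toNat

theorem size_cast : (C.size : ℤ) = 8 * C.r + 12 := by
  have := C.one_le
  unfold size
  omega

/-- The block `b` contains all cells of the macrotile of `t` that lie in its block. -/
def Shows (b : Block C.size) (t : Tile) : Prop :=
  ∀ i j : Fin C.size, C.Mem ((i : ℤ), (j : ℤ)) → b i j = some (C.side t ((i : ℤ), (j : ℤ)))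

open Classical in
/-- The tile represented by a block. -/
noncomputable def represent (T : Finset Tile) (b : Block C.size) : Option Tile :=
  if h : ∃ t ∈ T, C.Shows b t then some h.choose else none

variable {C} in
theorem represent_eq_some {T : Finset Tile} {b : Block C.size} {t : Tile}
    (h : C.represent T b = some t) : t ∈ T ∧ C.Shows b t := by
  unfold represent at h
  split_ifs at h with h'
  rw [Option.some.injEq] at h
  rw [← h]
  exact h'.choose_spec

theorem blockAt_eq (α : Assembly) (p : ℤ × ℤ) (i j : Fin C.size) :
    blockAt C.size α p.1 p.2 i j = α (((i : ℤ), (j : ℤ)) + C.base p) := by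
  unfold blockAt
  rw [size_cast]
  congr 1
  ext <;> simp [base, add_comm]

theorem exists_fin {x : ℤ} (h : 0 ≤ x) (h' : x < 8 * C.r + 12) : ∃ i : Fin C.size, (i : ℤ) = x :=
  ⟨⟨x.toNat, by have := C.size_cast; omega⟩, by simp [h]⟩

theorem shows_zero {b : Block C.size} {t : Tile} (h : C.Shows b t) : ∃ i : Fin C.size, (i : ℤ) = 0 ∧
    b i i = some (C.side t 0) := by
  obtain ⟨i, hi⟩ := C.exists_fin (x := 0) le_rfl (by have := C.one_le; omega)
  have := h i i (by rw [hi]; exact C.mem_zero)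
  rw [hi] at this
  exact ⟨i, hi, this⟩

theorem repr_enlarge {T : Finset Tile} (hT : ∀ t ∈ T, ∀ d, t d ∈ C.glueSet) {α : Assembly}
    (hα : IsOver T α) : repr (C.represent T) (C.enlarge α) = α := by
  funext p
  unfold repr
  have hcell : ∀ i j : Fin C.size, C.Mem ((i : ℤ), (j : ℤ)) →
      blockAt C.size (C.enlarge α) p.1 p.2 i j =
        (α p).map fun t => C.side t ((i : ℤ), (j : ℤ)) := by
    intro i j h
    rw [blockAt_eq, C.enlarge_add_base α h]
  rcases hp : α p with _ | t
  -- The block of an empty cell may contain teeth of neighbours, but its south-west corner belongs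
  -- to its own macrotile, hence is empty, and so no tile is shown.
  · rcases hR : C.represent T (blockAt C.size (C.enlarge α) p.1 p.2) with _ | t
    · rfl
    · obtain ⟨i, hi, e⟩ := C.shows_zero (represent_eq_some hR).2
      rw [hcell i i (by rw [hi]; exact C.mem_zero), hp] at e
      cases e
  · have hS : C.Shows (blockAt C.size (C.enlarge α) p.1 p.2) t := by
      intro i j h
      rw [hcell i j h, hp, Option.map_some]
    have htT := hα p t hp
    have hex : ∃ t ∈ T, C.Shows (blockAt C.size (C.enlarge α) p.1 p.2) t := ⟨t, htT, hS⟩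
    -- The choice in `represent` is unambiguous, by the record in the interior.
    rw [represent, dif_pos hex, Option.some.injEq]
    refine C.eq_of_side_eq (hT _ hex.choose_spec.1) (hT t htT) fun x h1 h2 h3 h4 hx => ?_
    obtain ⟨i, hi⟩ := C.exists_fin h1 h2
    obtain ⟨j, hj⟩ := C.exists_fin h3 h4
    have hx' : C.Mem ((i : ℤ), (j : ℤ)) := by rw [hi, hj]; exact hx
    have e1 := hex.choose_spec.2 i j hx'
    rw [hS i j hx', Option.some.injEq, hi, hj] at e1
    exact e1.symm

/-- A represented block has the corner glue on the west side of its cell (0, 0), and in every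
macrotile that glue marks the south-west corner only. -/
theorem aligned_of_repr {T : Finset Tile} {α : Assembly} {u : ℤ × ℤ}
    (h : (dom (repr (C.represent T) (translate u (C.enlarge α)))).Nonempty) :
    ∃ w, u = C.base w := by
  obtain ⟨p, hp⟩ := h
  obtain ⟨t, ht⟩ := mem_dom.1 hp
  obtain ⟨i, hi, e⟩ := C.shows_zero (represent_eq_some ht).2
  rw [blockAt_eq, hi, show ((0 : ℤ), (0 : ℤ)) = 0 from rfl, zero_add, translate_apply] at e
  obtain ⟨s, -, hs⟩ := C.enlarge_eq_some.1 e
  have hw := congrFun hs .west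
  rw [side_zero_west] at hw
  have h0 := C.side_eq_cornerGlue hw
  refine ⟨p - C.own (C.base p - u), ?_⟩
  rw [base_sub, eq_sub_iff_add_eq, ← sub_eq_zero, ← neg_eq_zero, ← h0]
  abel

theorem superRepr_enlarge {T : Finset Tile} (hT : ∀ t ∈ T, ∀ d, t d ∈ C.glueSet) {α : Assembly}
    (hα : IsOver T α) (hne : (dom α).Nonempty) :
    superRepr (C.represent T) (supertile (C.enlarge α)) = supertile α := by
  ext β
  constructor
  · rintro ⟨h1, γ, ⟨u, rfl⟩, rfl⟩
    obtain ⟨w, rfl⟩ := C.aligned_of_repr h1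
    refine ⟨w, ?_⟩
    rw [← enlarge_translate, C.repr_enlarge hT (hα.translate w)]
  · rintro ⟨w, rfl⟩
    refine ⟨?_, _, ⟨C.base w, rfl⟩, ?_⟩
    · obtain ⟨x, hx⟩ := hne
      exact ⟨x + w, by rw [mem_dom_translate]; simpa using hx⟩
    · rw [← enlarge_translate, C.repr_enlarge hT (hα.translate w)]

/-- A represented block carries tiles in its cells (0, 0) and (1, 0), hence more than one tile. -/
theorem superRepr_single (T : Finset Tile) (t : Tile) :
    superRepr (C.represent T) (supertile (single t)) = ∅ := by
  rw [Set.eq_empty_iff_forall_notMem]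
  rintro β ⟨⟨p, hp⟩, _, ⟨u, rfl⟩, rfl⟩
  obtain ⟨s, hs⟩ := mem_dom.1 hp
  have hS := (represent_eq_some hs).2
  have h1 := C.one_le
  obtain ⟨i, hi⟩ := C.exists_fin (x := 0) le_rfl (by omega)
  obtain ⟨j, hj⟩ := C.exists_fin (x := 1) (by omega) (by omega)
  have e1 := hS i i (by rw [hi]; exact C.mem_zero)
  have e2 := hS j i (by rw [hi, hj]; unfold Mem shape slot; omega)
  rw [blockAt_eq, translate_apply, single_eq_some, hi] at e1
  rw [blockAt_eq, translate_apply, single_eq_some, hi, hj] at e2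
  have e3 := congrArg Prod.fst (e1.1.trans e2.1.symm)
  simp at e3

/-- The enlarged initial supertiles. -/
def enlargedInit (T : TAS) : Set (Set Assembly) :=
  {s | ∃ α, supertile α ∈ T.init ∧ s = supertile (C.enlarge α)}

/-- The macrotiles of `C` are suitable for the simulation of `T`. -/
structure Fits (T : TAS) : Prop where
  temp_eq : T.temp = C.temp
  glue_mem : ∀ t ∈ T.tiles, ∀ d, t d ∈ C.glueSet

variable {C} {T : TAS}

theorem Fits.covers (h : C.Fits T) {α : Assembly} (hα : IsOver T.tiles α) : C.Covers α :=
  fun x t hx => h.glue_mem t (hα x t hx)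

/-- The simulating system. -/
noncomputable def Fits.system (h : C.Fits T) : TAS where
  tiles := universalTiles C.innerStrength
  init := singletons (universalTiles C.innerStrength) ∪ C.enlargedInit T
  temp := C.temp
  init_spec := by
    rintro s (⟨t, ht, rfl⟩ | ⟨α, hα, rfl⟩)
    · refine ⟨_, ⟨0, mem_dom_single.2 rfl⟩, ?_, stable_single _ _, rfl⟩
      intro x s hs
      rw [← (single_eq_some.1 hs).2]
      exact ht
    · obtain ⟨h1, h2, h3⟩ := (Reachable.init _ hα).of_supertile
      rw [h.temp_eq] at h3
      exact ⟨_, C.nonempty_dom_enlarge h1, C.isOver_enlarge α,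
        C.stable_enlarge (h.covers h2) h3, rfl⟩

/-- Everything that can be attached to a translation of an enlarged assembly. -/
theorem Fits.attach (h : C.Fits T) {α β : Assembly} (hα : Reachable T (supertile α) ∨
    supertile α ∈ producible T) (hβ : (dom β).Nonempty) {u v : ℤ × ℤ}
    (hd : Disjoint (dom (translate u (C.enlarge α))) (dom (translate v (C.enlarge β))))
    (hs : Stable C.temp (union (translate u (C.enlarge α)) (translate v (C.enlarge β)))) :
    ∃ w, Disjoint (dom α) (dom (translate w β)) ∧ Stable T.temp (union α (translate w β)) ∧
      union (translate u (C.enlarge α)) (translate v (C.enlarge β)) =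
        translate u (C.enlarge (union α (translate w β))) := by
  have hne : (dom α).Nonempty :=
    hα.elim (fun h => h.of_supertile.1) dom_nonempty_of_producible
  obtain ⟨w, rfl⟩ := C.aligned_of_stable hne hβ hd hs
  have e : union (translate u (C.enlarge α)) (translate (u + C.base w) (C.enlarge β)) =
      translate u (C.enlarge (union α (translate w β))) := by
    rw [← translate_translate, ← enlarge_translate, ← translate_union, ← enlarge_union]
  refine ⟨w, ?_, ?_, e⟩
  · rwa [← translate_translate, ← enlarge_translate, disjoint_translate_iff,
      disjoint_enlarge_iff] at hd
  · rw [e, stable_translate_iff] at hs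
    rw [h.temp_eq]
    exact C.stable_of_stable_enlarge hs

/-! ### Productions of the simulating system -/

theorem not_combine_single {t : Tile} (ht : t ∈ universalTiles C.innerStrength)
    {b c : Set Assembly} (hb : (∃ s, b = supertile (single s)) ∨
      ∃ β, (dom β).Nonempty ∧ b = supertile (C.enlarge β))
    (hc : c ∈ combine C.temp (supertile (single t)) b) : False := by
  obtain ⟨_, ⟨u, rfl⟩, β, hβ, hd, hs, rfl⟩ := hc
  rcases hb with ⟨s, rfl⟩ | ⟨β', hne, rfl⟩
  · obtain ⟨v, rfl⟩ := hβ
    exact C.not_stable_single_single ht hd hs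
  · obtain ⟨v, rfl⟩ := hβ
    exact C.not_stable_single_enlarge ht hne hd hs

theorem combine_comm {τ : ℕ} {a b c : Set Assembly} (h : c ∈ combine τ a b) :
    c ∈ combine τ b a := by
  obtain ⟨α, hα, β, hβ, hd, hs, rfl⟩ := h
  refine ⟨β, hβ, α, hα, hd.symm, ?_, ?_⟩ <;> rw [union_comm hd.symm]
  exact hs

/-- The two classes are closed under attachment: single tiles attach to nothing, and two
enlargements attach only in alignment, which is an attachment of the assemblies that they enlarge.
-/
theorem Fits.reachable_cases (h : C.Fits T) {s : Set Assembly} (hs : Reachable h.system s) :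
    (∃ t ∈ universalTiles C.innerStrength, s = supertile (single t)) ∨
      ∃ α, Reachable T (supertile α) ∧ s = supertile (C.enlarge α) := by
  induction hs with
  | init s hs =>
    rcases hs with ⟨t, ht, rfl⟩ | ⟨α, hα, rfl⟩
    · exact .inl ⟨t, ht, rfl⟩
    · exact .inr ⟨α, .init _ hα, rfl⟩
  | attach a b c _ _ hc iha ihb =>
    change c ∈ combine C.temp a b at hc
    have weak : ∀ {s}, ((∃ t ∈ universalTiles C.innerStrength, s = supertile (single t)) ∨
        ∃ α, Reachable T (supertile α) ∧ s = supertile (C.enlarge α)) →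
        (∃ t, s = supertile (single t)) ∨
          ∃ β, (dom β).Nonempty ∧ s = supertile (C.enlarge β) := by
      rintro s (⟨t, -, e⟩ | ⟨α, hα, e⟩)
      · exact .inl ⟨t, e⟩
      · exact .inr ⟨α, hα.of_supertile.1, e⟩
    rcases iha with ⟨t, ht, rfl⟩ | ⟨α, hα, rfl⟩
    · exact (not_combine_single ht (weak ihb) hc).elim
    rcases ihb with ⟨t, ht, rfl⟩ | ⟨β, hβ, rfl⟩
    · exact (not_combine_single ht (weak (.inr ⟨α, hα, rfl⟩)) (combine_comm hc)).elim
    obtain ⟨_, ⟨u, rfl⟩, _, ⟨v, rfl⟩, hd, hs, rfl⟩ := hc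
    obtain ⟨w, h1, h2, h3⟩ := h.attach (.inl hα) hβ.of_supertile.1 hd hs
    refine .inr ⟨union α (translate w β), ?_, ?_⟩
    · exact .attach _ _ _ hα hβ ⟨_, mem_supertile_self _, _, ⟨w, rfl⟩, h1, h2, rfl⟩
    · rw [h3, supertile_translate]

theorem Fits.stable_enlarge_union (h : C.Fits T) {α β : Assembly} (hα : IsOver T.tiles α)
    (hβ : IsOver T.tiles β) (hs : Stable T.temp (union α β)) :
    Stable C.temp (union (C.enlarge α) (C.enlarge β)) := by
  rw [← enlarge_union]
  exact C.stable_enlarge (h.covers (hα.union hβ)) (h.temp_eq ▸ hs)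

theorem enlarge_mem_supertile {α β : Assembly} (h : α ∈ supertile β) :
    C.enlarge α ∈ supertile (C.enlarge β) := by
  obtain ⟨u, rfl⟩ := h
  exact ⟨C.base u, C.enlarge_translate u β⟩

theorem Fits.combine_enlarge (h : C.Fits T) {a b c : Set Assembly} {α β γ : Assembly}
    (ha : a = supertile α) (hb : b = supertile β) (hc : supertile γ = c)
    (hα : IsOver T.tiles α) (hβ : IsOver T.tiles β) (hcomb : c ∈ combine T.temp a b) :
    supertile (C.enlarge γ) ∈
      combine C.temp (supertile (C.enlarge α)) (supertile (C.enlarge β)) := by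
  obtain ⟨α', hα', β', hβ', hd, hs, rfl⟩ := hcomb
  subst ha hb
  have hγ : γ ∈ supertile (union α' β') := hc ▸ mem_supertile_self γ
  refine ⟨C.enlarge α', enlarge_mem_supertile hα', C.enlarge β', enlarge_mem_supertile hβ',
    ?_, ?_, ?_⟩
  · rwa [disjoint_enlarge_iff]
  · obtain ⟨u, rfl⟩ := hα'
    obtain ⟨v, rfl⟩ := hβ'
    exact h.stable_enlarge_union (hα.translate u) (hβ.translate v) hs
  · rw [← enlarge_union]
    exact supertile_eq_of_mem (enlarge_mem_supertile hγ)

theorem Fits.reachable_enlarge (h : C.Fits T) {s : Set Assembly} (hs : Reachable T s) :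
    ∀ α, s = supertile α → Reachable h.system (supertile (C.enlarge α)) := by
  induction hs with
  | init s hs =>
    rintro α rfl
    exact .init _ (.inr ⟨α, hs, rfl⟩)
  | attach a b c ha hb hc iha ihb =>
    rintro γ hγ
    obtain ⟨α, hα, -, hα', -⟩ := ha.spec
    obtain ⟨β, hβ, -, hβ', -⟩ := hb.spec
    exact .attach _ _ _ (iha α hα) (ihb β hβ) (h.combine_enlarge hα hβ hγ.symm hα' hβ' hc)

/-- Enlarging commutes with unions and limits, so an assembly sequence can be enlarged term by term.
-/
theorem Fits.producible_enlarge (h : C.Fits T) {α : Assembly} (hα : supertile α ∈ producible T) :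
    supertile (C.enlarge α) ∈ producible h.system := by
  obtain ⟨f, f0, fc, fl⟩ := mem_producible_iff.1 hα
  have fr := fc.reachable (.init _ f0)
  refine mem_producible_iff.2 ⟨fun i => C.enlarge (f i), .inr ⟨_, f0, rfl⟩, ?_, ?_⟩
  · intro i
    rcases fc i with e | ⟨β, h1, h2, h3, h4⟩
    · left; dsimp only; rw [e]
    · refine .inr ⟨C.enlarge β, h.reachable_enlarge h1 β rfl, ?_, ?_, ?_⟩
      · rwa [disjoint_enlarge_iff]
      · exact h.stable_enlarge_union (fr i).of_supertile.2.1 h1.of_supertile.2.1 h3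
      · dsimp only; rw [h4, enlarge_union]
  · intro x t
    simp only [enlarge_eq_some]
    constructor
    · rintro ⟨s, hs, e⟩
      obtain ⟨i, hi⟩ := (fl _ _).1 hs
      exact ⟨i, s, hi, e⟩
    · rintro ⟨i, s, hs, e⟩
      exact ⟨s, (fl _ _).2 ⟨i, hs⟩, e⟩

theorem Fits.producible_cases (h : C.Fits T) {s : Set Assembly} (hs : s ∈ producible h.system) :
    (∃ t ∈ universalTiles C.innerStrength, s = supertile (single t)) ∨
      ∃ α, supertile α ∈ producible T ∧ s = supertile (C.enlarge α) := by
  obtain ⟨γ, rfl⟩ := exists_of_mem_producible hs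
  obtain ⟨f, f0, fc, fl⟩ := mem_producible_iff.1 hs
  change Chain C.temp (Reachable h.system) f at fc
  rcases f0 with ⟨t, ht, f0⟩ | ⟨α₀, hα₀, f0⟩
  · left
    -- A sequence that starts with a single tile can only pause.
    have hf : ∀ i, f i = f 0 := by
      intro i
      induction i with
      | zero => rfl
      | succ i ih =>
        rcases fc i with e | ⟨β, h1, h2, h3, -⟩
        · rw [e, ih]
        · exfalso
          refine not_combine_single (b := supertile β) ht ?_
            ⟨f i, ?_, β, mem_supertile_self β, h2, h3, rfl⟩
          · rcases h.reachable_cases h1 with ⟨t, -, e⟩ | ⟨α, hα, e⟩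
            · exact .inl ⟨t, e⟩
            · exact .inr ⟨α, hα.of_supertile.1, e⟩
          · rw [ih, ← f0]
            exact mem_supertile_self _
    refine ⟨t, ht, ?_⟩
    rw [← f0]
    congr 1
    refine fl.unique fun x s => ⟨fun h => ⟨0, h⟩, fun ⟨i, hi⟩ => hf i ▸ hi⟩
  · right
    obtain ⟨u, hu⟩ : f 0 ∈ supertile (C.enlarge α₀) := f0 ▸ mem_supertile_self _
    have step : ∀ i, ∀ α, f i = translate u (C.enlarge α) → Reachable T (supertile α) →
        ∃ α', f (i + 1) = translate u (C.enlarge α') ∧ Reachable T (supertile α') ∧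
          (α' = α ∨ ∃ β : Assembly, Reachable T (supertile β) ∧ Disjoint (dom α) (dom β) ∧
            Stable T.temp (union α β) ∧ α' = union α β) := by
      intro i α hi hα
      rcases fc i with e | ⟨β, h1, h2, h3, h4⟩
      · exact ⟨α, e.trans hi, hα, .inl rfl⟩
      · rw [hi] at h2 h3 h4
        rcases h.reachable_cases h1 with ⟨t, ht, e⟩ | ⟨β', hβ', e⟩
        · exfalso
          refine not_combine_single (b := supertile (C.enlarge α)) ht
            (.inr ⟨α, hα.of_supertile.1, rfl⟩)
            (combine_comm ⟨_, ⟨u, rfl⟩, β, e ▸ mem_supertile_self β, h2, h3, rfl⟩)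
        · obtain ⟨v, rfl⟩ : β ∈ supertile (C.enlarge β') := e ▸ mem_supertile_self _
          obtain ⟨w, k1, k2, k3⟩ := h.attach (.inl hα) hβ'.of_supertile.1 h2 h3
          refine ⟨union α (translate w β'), h4.trans k3, ?_, .inr ⟨_, ?_, k1, k2, rfl⟩⟩
          · exact .attach _ _ _ hα hβ' ⟨_, mem_supertile_self _, _, ⟨w, rfl⟩, k1, k2, rfl⟩
          · rwa [supertile_translate]
    -- The sequence is pulled back step by step, with the translation `u` of its start kept
    -- throughout; the limit of the pulled back sequence enlarges to the given one.
    choose! nxt n1 n2 n3 using step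
    set g : ℕ → Assembly := fun i => Nat.rec α₀ (fun i α => nxt i α) i with hg
    have hgs : ∀ i, f i = translate u (C.enlarge (g i)) ∧ Reachable T (supertile (g i)) := by
      intro i
      induction i with
      | zero => exact ⟨hu, .init _ hα₀⟩
      | succ i ih => exact ⟨n1 i _ ih.1 ih.2, n2 i _ ih.1 ih.2⟩
    have gc : Chain T.temp (Reachable T) g := fun i => n3 i _ (hgs i).1 (hgs i).2
    obtain ⟨δ, hδ⟩ := gc.exists_isLimit
    refine ⟨δ, mem_producible_iff.2 ⟨g, hα₀, gc, hδ⟩, ?_⟩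
    have : γ = translate u (C.enlarge δ) := by
      refine fl.unique fun x t => ?_
      rw [translate_apply, enlarge_eq_some]
      constructor
      · rintro ⟨s, hs, e⟩
        obtain ⟨i, hi⟩ := (hδ _ _).1 hs
        refine ⟨i, ?_⟩
        rw [(hgs i).1, translate_apply, enlarge_eq_some]
        exact ⟨s, hi, e⟩
      · rintro ⟨i, hi⟩
        rw [(hgs i).1, translate_apply, enlarge_eq_some] at hi
        obtain ⟨s, hs, e⟩ := hi
        exact ⟨s, (hδ _ _).2 ⟨i, hs⟩, e⟩
    rw [this, supertile_translate]

theorem Fits.superRepr_enlarge (h : C.Fits T) {α : Assembly} (hα : supertile α ∈ producible T) :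
    superRepr (C.represent T.tiles) (supertile (C.enlarge α)) = supertile α :=
  C.superRepr_enlarge h.glue_mem (isOver_of_producible hα) (dom_nonempty_of_producible hα)

/-- Besides its own macrotile, a block meets only the teeth of the west and south neighbours. This
is what clean mapping needs. -/
theorem blockAt_nonEmpty {α : Assembly} {u : ℤ × ℤ} {x y : ℤ}
    (h : (blockAt C.size (translate (C.base u) (C.enlarge α)) x y).NonEmpty) :
    (x - 1, y) ∈ dom (translate u α) ∨ (x, y - 1) ∈ dom (translate u α) ∨
      (x, y) ∈ dom (translate u α) := by
  obtain ⟨i, j, hij⟩ := h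
  rw [C.blockAt_eq _ (x, y), ← enlarge_translate] at hij
  have hd := C.mem_dom_enlarge.1 (show _ ∈ dom (C.enlarge (translate u α)) from hij)
  have hm := C.size_cast
  have hi : (i : ℤ) < 8 * C.r + 12 := by rw [← hm]; exact_mod_cast i.2
  have hj : (j : ℤ) < 8 * C.r + 12 := by rw [← hm]; exact_mod_cast j.2
  have hpos : (8 * C.r + 12) ≠ 0 := by have := C.one_le; omega
  have e := owner_cases C.r ((i : ℤ) + (8 * C.r + 12) * x) ((j : ℤ) + (8 * C.r + 12) * y)
  rw [Int.add_mul_ediv_left _ _ hpos, Int.add_mul_ediv_left _ _ hpos,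
    Int.ediv_eq_zero_of_lt (by omega) hi, Int.ediv_eq_zero_of_lt (by omega) hj, zero_add,
    zero_add] at e
  dsimp only at e
  change C.own (((i : ℤ), (j : ℤ)) + C.base (x, y)) = _ ∨
    C.own (((i : ℤ), (j : ℤ)) + C.base (x, y)) = _ ∨
    C.own (((i : ℤ), (j : ℤ)) + C.base (x, y)) = _ at e
  rcases e with e | e | e
  · exact .inl (e ▸ hd)
  · exact .inr (.inl (e ▸ hd))
  · exact .inr (.inr (e ▸ hd))

theorem Fits.mapsCleanly (h : C.Fits T) {a : Set Assembly} (ha : a ∈ producible h.system) :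
    SupertileMapsCleanly (C.represent T.tiles) T.tiles a := by
  rcases h.producible_cases ha with ⟨t, ht, rfl⟩ | ⟨α, hα, rfl⟩
  · refine ⟨fun hne => ?_, fun _ => ⟨_, mem_supertile_self _, ?_⟩⟩
    · rw [superRepr_single] at hne
      exact absurd hne Set.not_nonempty_empty
    · have h0 : ∀ x y, (blockAt C.size (single t) x y).NonEmpty → x = 0 ∧ y = 0 := by
        rintro x y ⟨i, j, hij⟩
        have hx := mem_dom_single.1 (show _ ∈ dom (single t) from hij)
        simp only [Prod.ext_iff, Prod.fst_zero, Prod.snd_zero] at hx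
        have hi : (i : ℤ) < C.size := by exact_mod_cast i.2
        have hj : (j : ℤ) < C.size := by exact_mod_cast j.2
        have hi0 : (0 : ℤ) ≤ i := by omega
        have hj0 : (0 : ℤ) ≤ j := by omega
        constructor
        · nlinarith [hx.1]
        · nlinarith [hx.2]
      intro x y x' y' h1 h2
      obtain ⟨rfl, rfl⟩ := h0 _ _ h1
      obtain ⟨rfl, rfl⟩ := h0 _ _ h2
      exact ⟨rfl, rfl⟩
  · refine ⟨fun _ => ⟨⟨α, isOver_of_producible hα, h.superRepr_enlarge hα⟩, ?_⟩, fun he => ?_⟩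
    · rintro _ ⟨u, rfl⟩ hne
      obtain ⟨w, rfl⟩ := C.aligned_of_repr hne
      rw [← enlarge_translate, C.repr_enlarge h.glue_mem ((isOver_of_producible hα).translate w)]
      left
      intro x y hb
      rw [enlarge_translate] at hb
      rcases blockAt_nonEmpty hb with hb | hb | hb
      · exact ⟨-1, 0, by simp, by simp, by norm_num, by rwa [← sub_eq_add_neg, add_zero]⟩
      · exact ⟨0, -1, by simp, by simp, by norm_num, by rwa [← sub_eq_add_neg, add_zero]⟩
      · exact ⟨0, 0, by simp, by simp, by norm_num, by simpa using hb⟩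
    · rw [h.superRepr_enlarge hα] at he
      exact absurd (he ▸ mem_supertile_self α) (Set.notMem_empty _)

/-! ### The conditions of strong simulation -/

theorem Fits.equivalentProductions (h : C.Fits T) :
    EquivalentProductions (C.represent T.tiles) h.system T := by
  refine ⟨?_, fun a ha => h.mapsCleanly ha⟩
  ext b
  constructor
  · rintro ⟨a, ha, hne, rfl⟩
    rcases h.producible_cases ha with ⟨t, ht, rfl⟩ | ⟨α, hα, rfl⟩
    · rw [superRepr_single] at hne
      exact absurd hne Set.not_nonempty_empty
    · rwa [h.superRepr_enlarge hα]
  · intro hb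
    obtain ⟨β, rfl⟩ := exists_of_mem_producible hb
    refine ⟨_, h.producible_enlarge hb, ?_, h.superRepr_enlarge hb⟩
    rw [h.superRepr_enlarge hb]
    exact ⟨_, mem_supertile_self β⟩

/-- Only an aligned enlargement can attach to an enlargement, so each such attachment represents
exactly one attachment in the simulated system. -/
theorem Fits.follows (h : C.Fits T) : Follows (C.represent T.tiles) h.system T := by
  rintro a ha b hb ⟨c, hc, hbc⟩ hne -
  rcases h.producible_cases ha with ⟨t, ht, rfl⟩ | ⟨α, hα, rfl⟩
  · rw [superRepr_single] at hne
    exact absurd hne Set.not_nonempty_empty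
  change b ∈ combine C.temp _ _ at hbc
  rcases h.producible_cases hc with ⟨t, ht, rfl⟩ | ⟨γ, hγ, rfl⟩
  · exact (not_combine_single ht (.inr ⟨α, dom_nonempty_of_producible hα, rfl⟩)
      (combine_comm hbc)).elim
  obtain ⟨_, ⟨u, rfl⟩, _, ⟨v, rfl⟩, hd, hs, rfl⟩ := hbc
  obtain ⟨w, h1, h2, h3⟩ := h.attach (.inr hα) (dom_nonempty_of_producible hγ) hd hs
  have hcomb : supertile (union α (translate w γ)) ∈
      combine T.temp (supertile α) (supertile γ) :=
    ⟨_, mem_supertile_self _, _, ⟨w, rfl⟩, h1, h2, rfl⟩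
  rw [h.superRepr_enlarge hα, h3, supertile_translate,
    h.superRepr_enlarge (combine_subset_producible hα hγ hcomb)]
  exact ⟨_, hγ, hcomb⟩

theorem growsTo_refl {S : TAS} (α : Assembly) : GrowsTo S (supertile α) (supertile α) :=
  ⟨fun _ => α, mem_supertile_self α, fun _ => .inl rfl, α,
    fun _ _ => ⟨fun h => ⟨0, h⟩, fun ⟨_, h⟩ => h⟩, rfl⟩

theorem Fits.exists_of_superRepr (h : C.Fits T) {a a' : Set Assembly} (ha : a ∈ producible T)
    (ha' : a' ∈ producible h.system) (e : superRepr (C.represent T.tiles) a' = a) :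
    ∃ α, a = supertile α ∧ a' = supertile (C.enlarge α) := by
  rcases h.producible_cases ha' with ⟨t, ht, rfl⟩ | ⟨α, hα, rfl⟩
  · rw [superRepr_single] at e
    obtain ⟨α, rfl⟩ := exists_of_mem_producible ha
    exact absurd (e ▸ mem_supertile_self α) (Set.notMem_empty _)
  · rw [h.superRepr_enlarge hα] at e
    exact ⟨α, e.symm, rfl⟩

/-- A supertile that represents something is the enlargement of what it represents, so it can attach
at once and the preparatory growth is empty. -/
theorem Fits.stronglyModels (h : C.Fits T) : StronglyModels (C.represent T.tiles) h.system T := by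
  intro a ha b hb c hc a' ha' b' hb' ea eb
  obtain ⟨α, rfl, rfl⟩ := h.exists_of_superRepr ha ha' ea
  obtain ⟨β, rfl, rfl⟩ := h.exists_of_superRepr hb hb' eb
  have hcp := combine_subset_producible ha hb hc
  obtain ⟨γ, rfl⟩ := exists_of_mem_producible hcp
  exact ⟨_, ha', _, hb', _, h.producible_enlarge hcp, growsTo_refl _, growsTo_refl _, ea, eb,
    h.superRepr_enlarge hcp, h.combine_enlarge rfl rfl rfl (isOver_of_producible ha)
      (isOver_of_producible hb) hc⟩

theorem Fits.stronglySimulates (h : C.Fits T) :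
    StronglySimulates (C.represent T.tiles) h.system T :=
  ⟨fun _ _ hb => (represent_eq_some hb).1, h.equivalentProductions, h.follows, h.stronglyModels⟩

/-- Decoding by `superRepr` inverts the enlargement of initial supertiles. -/
theorem Fits.nonempty_equiv (h : C.Fits T) : Nonempty (C.enlargedInit T ≃ T.init) := by
  have hprod : ∀ {α}, supertile α ∈ T.init → supertile α ∈ producible T := fun {α} hα =>
    mem_producible_iff.2 ⟨fun _ => α, hα, fun _ => .inl rfl,
      fun _ _ => ⟨fun h => ⟨0, h⟩, fun ⟨_, h⟩ => h⟩⟩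
  refine ⟨Equiv.ofBijective (fun s => ⟨superRepr (C.represent T.tiles) s.1, ?_⟩) ⟨?_, ?_⟩⟩
  · obtain ⟨_, α, hα, rfl⟩ := s
    dsimp only
    rwa [h.superRepr_enlarge (hprod hα)]
  · rintro ⟨_, α, hα, rfl⟩ ⟨_, β, hβ, rfl⟩ e
    simp only [Subtype.mk.injEq] at e ⊢
    rw [h.superRepr_enlarge (hprod hα), h.superRepr_enlarge (hprod hβ)] at e
    exact Subtype.ext (supertile_eq_of_mem (enlarge_mem_supertile (e ▸ mem_supertile_self α)))
  · rintro ⟨s, hs⟩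
    obtain ⟨α, -, -, -, rfl⟩ := T.init_spec s hs
    exact ⟨⟨_, α, hs, rfl⟩, Subtype.ext (h.superRepr_enlarge (hprod hs))⟩

theorem finite_of_mem_enlargedInit (hT : ∀ s ∈ T.init, ∀ α ∈ s, (dom α).Finite) :
    ∀ s ∈ C.enlargedInit T, ∀ α ∈ s, (dom α).Finite := by
  rintro _ ⟨α, hα, rfl⟩ _ ⟨u, rfl⟩
  refine ((C.finite_dom_enlarge (hT _ hα α (mem_supertile_self α))).image fun x => x + u).subset ?_
  intro x hx
  exact ⟨x - u, hx, by simp⟩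

end Code

/-! ### Pad positions and the scale factor -/

theorem finite_glues (T : Finset Tile) : (glues T).Finite := by
  refine (T.finite_toSet.biUnion fun t _ => Set.finite_range t).subset ?_
  rintro g ⟨t, ht, d, rfl⟩
  exact Set.mem_biUnion ht ⟨d, rfl⟩

/-- The pads of all glues fit on a macrotile of size proportional to the square root of their
number. -/
theorem exists_code (T : TAS) (hτ : 2 ≤ T.temp) :
    ∃ C : Code, C.temp = T.temp ∧ C.glueSet = glues T.tiles ∧
      C.r = Nat.sqrt ((glues T.tiles).ncard * T.temp) + 1 := by
  classical
  obtain ⟨N, hN⟩ : ∃ N, N = (glues T.tiles).ncard := ⟨_, rfl⟩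
  obtain ⟨r, hr⟩ : ∃ r, r = Nat.sqrt ((glues T.tiles).ncard * T.temp) + 1 := ⟨_, rfl⟩
  have hlt : N * T.temp < r * r := by
    rw [hr, hN]; exact Nat.sqrt_lt'.1 (Nat.lt_succ_self _) |>.trans_eq (sq _)
  have hfin := finite_glues T.tiles
  obtain ⟨idx, hidx, hinj⟩ : ∃ idx : Glue → ℕ, (∀ g ∈ glues T.tiles, idx g < N) ∧
      Set.InjOn idx (glues T.tiles) := by
    have : Fintype (glues T.tiles) := hfin.fintype
    have e : glues T.tiles ≃ Fin N := Fintype.equivFinOfCardEq (by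
      rw [hN, ← Nat.card_coe_set_eq, Nat.card_eq_fintype_card])
    refine ⟨fun g => if hg : g ∈ glues T.tiles then e ⟨g, hg⟩ else 0, ?_, ?_⟩
    · intro g hg
      dsimp only
      rw [dif_pos hg]
      exact (e ⟨g, hg⟩).2
    · intro g hg g' hg' h
      dsimp only at h
      rw [dif_pos hg, dif_pos hg'] at h
      exact congrArg Subtype.val (e.injective (Fin.ext h))
  have hr0 : 0 < r := by omega
  -- The pads are numbered `idx g * T.temp + j`, below r². The two base-r digits of this number give
  -- the place along a tooth and the tooth; consecutive teeth are 6 cells apart.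
  refine ⟨⟨r, by omega, T.temp, hτ, glues T.tiles, fun g j =>
    (((idx g * T.temp + j) % r : ℕ), 6 * ((idx g * T.temp + j) / r : ℕ)), ?_, ?_⟩, rfl, rfl, ?_⟩
  · intro g hg j hj
    have h1 : idx g * T.temp + j < r * r := by
      have := hidx g hg
      nlinarith
    have h2 := Nat.mod_lt (idx g * T.temp + j) hr0
    have h3 := Nat.div_lt_of_lt_mul h1
    unfold PadRange
    dsimp only
    generalize (idx g * T.temp + j) % r = a at *
    generalize (idx g * T.temp + j) / r = b at *
    omega
  · intro g hg j hj g' hg' j' hj' h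
    simp only [Prod.mk.injEq] at h
    have h1 : (idx g * T.temp + j) % r = (idx g' * T.temp + j') % r := by exact_mod_cast h.1
    have h2 : (idx g * T.temp + j) / r = (idx g' * T.temp + j') / r := by omega
    have h3 : idx g * T.temp + j = idx g' * T.temp + j' := by
      rw [← Nat.mod_add_div (idx g * T.temp + j) r, h1, h2, Nat.mod_add_div]
    have e1 : idx g = idx g' := by
      have a1 : (idx g * T.temp + j) / T.temp = idx g := by
        rw [mul_comm, Nat.mul_add_div (by omega), Nat.div_eq_of_lt hj, add_zero]
      have a2 : (idx g' * T.temp + j') / T.temp = idx g' := by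
        rw [mul_comm, Nat.mul_add_div (by omega), Nat.div_eq_of_lt hj', add_zero]
      rw [← a1, ← a2, h3]
    refine ⟨hinj hg hg' e1, ?_⟩
    rw [e1] at h3
    exact Nat.add_left_cancel h3
  · change (r : ℤ) = _
    rw [hr]
    push_cast
    rfl

/-- Let X be the square root on the right. Then X ≥ 1 and √(Nτ) ≤ X, so the left side is at most 8X
+ 20 ≤ 28X. Of the logarithm only nonnegativity matters. -/
theorem size_bound {N τ : ℕ} (hN : 1 ≤ N) (hτ : 2 ≤ τ) :
    8 * ((Nat.sqrt (N * τ) : ℝ) + 1) + 12 ≤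
      40 * Real.sqrt ((N : ℝ) * ((τ : ℝ) + Real.log N)) := by
  have hN' : (1 : ℝ) ≤ N := by exact_mod_cast hN
  have hτ' : (2 : ℝ) ≤ τ := by exact_mod_cast hτ
  have hlog := Real.log_nonneg hN'
  have h1 : (Nat.sqrt (N * τ) : ℝ) ≤ Real.sqrt ((N : ℝ) * ((τ : ℝ) + Real.log N)) := by
    apply Real.le_sqrt_of_sq_le
    have : ((Nat.sqrt (N * τ) : ℝ)) ^ 2 ≤ N * τ := by
      exact_mod_cast Nat.sqrt_le' (N * τ)
    nlinarith
  have h2 : 1 ≤ Real.sqrt ((N : ℝ) * ((τ : ℝ) + Real.log N)) := by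
    apply Real.le_sqrt_of_sq_le
    nlinarith
  linarith

end TwoHAM

theorem mainTheorem7 :
    ∃ (c : ℕ) (C : ℝ), ∀ τ : ℕ, 2 ≤ τ →
      ∃ U : Finset TwoHAM.Tile, U.card ≤ c ∧
        ∀ T : TwoHAM.TAS, T.temp = τ → T.tiles.Nonempty →
          ∃ (I : Set (Set TwoHAM.Assembly)) (S : TwoHAM.TAS) (m : ℕ)
            (R : TwoHAM.Block m → Option TwoHAM.Tile),
            Nonempty (I ≃ T.init) ∧
            ((∀ s ∈ T.init, ∀ α ∈ s, (TwoHAM.dom α).Finite) →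
              ∀ s ∈ I, ∀ α ∈ s, (TwoHAM.dom α).Finite) ∧
            S.tiles = U ∧ S.init = TwoHAM.singletons U ∪ I ∧ S.temp = τ ∧
            0 < m ∧
            (m : ℝ) ≤ C * Real.sqrt (((TwoHAM.glues T.tiles).ncard : ℝ) *
              ((τ : ℝ) + Real.log ((TwoHAM.glues T.tiles).ncard : ℝ))) ∧
            TwoHAM.StronglySimulates R S T := by
  -- Six palette glues on four sides give `6 ^ 4`; 40 is the constant of `size_bound`. The tile set
  -- depends on τ only through the inner strength.
  refine ⟨6 ^ 4, 40, fun τ hτ => ⟨TwoHAM.universalTiles ((τ + 1) / 2),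
    TwoHAM.card_universalTiles_le _, ?_⟩⟩
  rintro T rfl ⟨t, ht⟩
  obtain ⟨C, h1, h2, h3⟩ := TwoHAM.exists_code T hτ
  have hF : C.Fits T := ⟨h1.symm, fun t ht d => h2 ▸ ⟨t, ht, d, rfl⟩⟩
  have hU : TwoHAM.universalTiles C.innerStrength = TwoHAM.universalTiles ((T.temp + 1) / 2) := by
    rw [TwoHAM.Code.innerStrength, h1]
  have hsize := C.size_cast
  have hone := C.one_le
  refine ⟨C.enlargedInit T, hF.system, C.size, C.represent T.tiles, hF.nonempty_equiv,
    TwoHAM.Code.finite_of_mem_enlargedInit, hU, ?_, h1, by omega, ?_, hF.stronglySimulates⟩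
  · rw [← hU]; rfl
  · have hN : 1 ≤ (TwoHAM.glues T.tiles).ncard :=
      (Set.ncard_pos (TwoHAM.finite_glues T.tiles)).2 ⟨_, t, ht, .north, rfl⟩
    refine le_trans (le_of_eq ?_) (TwoHAM.size_bound hN hτ)
    have : ((C.size : ℤ) : ℝ) = ((8 * C.r + 12 : ℤ) : ℝ) := by rw [hsize]
    rw [h3] at this
    push_cast at this
    exact this
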